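/- **Setting.** Let $\mathcal D(\mathbb R)$ be the complex-valued test functions on $\mathbb R$, $\mathcal D'(\mathbb R)$ the Schwartz distributions, and $\mathcal D'_+(\mathbb R)$ the distributions supported by $[0,\infty)$. For $\varphi\in\mathcal D(\mathbb R)$ let $R_\varphi=\sup\{|x|:\varphi(x)\neq0\}$ if $\varphi\ne 0$, and $R_0=1$. For $n\ge 1$ let $\mathcal D_n$ be the set of all real-valued even $\varphi\in\mathcal D(\mathbb R)$ with $R_\varphi\le 1/n$, $\int\varphi=1$, $\int x^k\varphi(x)\,dx=0$ for $1\le k\le n$, $\int|\varphi|\le 1+1/n$ and $\sup|\varphi^{(k)}|\le R_\varphi^{-2(k+1)}$ for $0\le k\le n$. Let $\mathcal U$ be any ultrafilter on the set $\mathcal D(\mathbb R)$ that contains every $\mathcal D_n$; "a.e." means "for all $\varphi$ in some member of $\mathcal U$". $\widehat{\mathbb C}$ is the ring of nets $(A_\varphi)_{\varphi\in\mathcal D(\mathbb R)}$ in $\mathbb C$ that are moderate ($\exists m$: $|A_\varphi|\le R_\varphi^{-m}$ a.e.) modulo those that are negligible ($\forall p$: $|A_\varphi|\le R_\varphi^{p}$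 a.e.). $\widehat{\mathcal E(\mathbb R)}$ is the algebra of nets $(f_\varphi)$ in $C^\infty(\mathbb R)$ that are moderate (for all compact $K$ and all $k$ there is $m$ with $\sup_K|f_\varphi^{(k)}|\le R_\varphi^{-m}$ a.e.) modulo those that are negligible (for all compact $K$ and all $k,p$: $\sup_K|f_\varphi^{(k)}|\le R_\varphi^{p}$ a.e.). Write $q(\cdot)$ for classes; $q(f_\varphi)'=q(f_\varphi')$, $q(f_\varphi)(0)=q(f_\varphi(0))\in\widehat{\mathbb C}$, elements of $\widehat{\mathbb C}$ act as constants, and $\iota(T)=q(T\star\varphi)$ for $T\in\mathcal D'(\mathbb R)$. Let $\widehat{\rm span}(\mathcal D'_+(\mathbb R))$ be the $\widehat{\mathbb C}$-linear span of $\iota(\mathcal D'_+(\mathbb R))$ in $\widehat{\mathcal E(\mathbb R)}$; for $T\in\mathcal D'_+(\mathbb R)$ and $f=\sum_{n=1}^m\alpha_n\iota(T_n)$ with $\alpha_n\in\widehat{\mathbb C}$, $T_n\in\mathcal D'_+(\mathbb R)$, put $T\star f=\sum_{n=1}^m\alpha_n\,\iota(T\star T_n)$, which again lies in the span and does not depend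 on the representation of $f$. **Theorem (First Order ODE).** Let $a,b\in\mathbb R$, $a\ne0$, and let $g(t)=\frac1aH(t)e^{-bt/a}\in\mathcal D'_+(\mathbb R)$, where $H$ is the Heaviside function. Then $g$ is the Green function of $a\frac{d}{dt}+b$, in the sense that $g$ is supported by $[0,\infty)$ and $ag'+bg=\delta$. For every $f\in\widehat{\rm span}(\mathcal D'_+(\mathbb R))$ the initial value problem $$ay'+by=f,\qquad y(0)=0,$$ has a unique solution $y$ in $\widehat{\mathcal E(\mathbb R)}$, and it is given by $$y=g\star f-(g\star f)(0)\,\iota\big(e^{-bt/a}\big),$$ where $g\star f\in\widehat{\rm span}(\mathcal D'_+(\mathbb R))$ and $(g\star f)(0)\in\widehat{\mathbb C}$. -/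

import Mathlib

open scoped ContDiff

namespace GenFun

/-- Complex-valued test functions on the real line. -/
abbrev TestFn : Type := TestFunction (⊤ : TopologicalSpace.Opens ℝ) ℂ ⊤

/-- Schwartz distributions on the real line. -/
abbrev Dist : Type := TestFn →L[ℂ] ℂ

/-! ### Test functions -/

section TestFunctions

/-- A compactly supported smooth function as a test function. -/
noncomputable def mkTest (f : ℝ → ℂ) (hf : ContDiff ℝ ∞ f) (hs : HasCompactSupport f) : TestFn :=
  ⟨f, hf, hs, Set.subset_univ _⟩

@[simp] theorem mkTest_apply (f : ℝ → ℂ) (hf : ContDiff ℝ ∞ f) (hs : HasCompactSupport f)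
    (x : ℝ) : mkTest f hf hs x = f x := rfl

theorem smooth (φ : TestFn) : ContDiff ℝ ∞ φ := φ.contDiff

/-- The test function `y ↦ φ (x - y)`. -/
noncomputable def shift (φ : TestFn) (x : ℝ) : TestFn :=
  mkTest (fun y => φ (x - y)) ((smooth φ).comp (contDiff_const.sub contDiff_id))
    (φ.hasCompactSupport.comp_homeomorph (Homeomorph.subLeft x))

@[simp] theorem shift_apply (φ : TestFn) (x y : ℝ) : shift φ x y = φ (x - y) := rfl

/-- The test function `y ↦ φ (-y)`. -/
noncomputable def reflect (φ : TestFn) : TestFn := shift φ 0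

/-- The derivative of a test function. -/
noncomputable def derivTest (φ : TestFn) : TestFn :=
  mkTest (deriv φ) ((contDiff_infty_iff_deriv.1 (smooth φ)).2) φ.hasCompactSupport.deriv

@[simp] theorem derivTest_apply (φ : TestFn) (x : ℝ) : derivTest φ x = deriv φ x := rfl

theorem coe_derivTest_iterate (k : ℕ) (φ : TestFn) :
    ⇑(derivTest^[k] φ) = iteratedDeriv k φ := by
  induction k generalizing φ with
  | zero => simp
  | succ k ih => rw [Function.iterate_succ_apply, ih, iteratedDeriv_succ']; rfl

theorem iteratedDeriv_bounded (φ : TestFn) (k : ℕ) :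
    ∃ C, 0 ≤ C ∧ ∀ x, ‖iteratedDeriv k φ x‖ ≤ C := by
  rw [← coe_derivTest_iterate]
  obtain ⟨C, hC⟩ := (derivTest^[k] φ).hasCompactSupport.exists_bound_of_continuous
    (derivTest^[k] φ).continuous
  exact ⟨C, (norm_nonneg _).trans (hC 0), hC⟩

theorem exists_support_bound (φ : TestFn) : ∃ A, 0 ≤ A ∧ ∀ x, A < |x| → φ x = 0 := by
  obtain ⟨A, hA⟩ := φ.hasCompactSupport.isCompact.isBounded.subset_closedBall 0
  refine ⟨max A 0, le_max_right _ _, fun x hx => ?_⟩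
  by_contra h
  have := hA (subset_tsupport _ h)
  rw [Metric.mem_closedBall, Real.dist_eq, sub_zero] at this
  exact absurd (this.trans (le_max_left _ _)) (not_le.2 hx)

/-- The radius of support of a test function. -/
noncomputable def radius (φ : TestFn) : ℝ :=
  open scoped Classical in if φ = 0 then 1 else sSup ((fun x : ℝ => |x|) '' Function.support φ)

theorem radius_nonneg (φ : TestFn) : 0 ≤ radius φ := by
  unfold radius
  split_ifs
  · exact zero_le_one
  · exact Real.sSup_nonneg (by rintro _ ⟨x, -, rfl⟩; exact abs_nonneg x)

theorem abs_le_radius {φ : TestFn} {x : ℝ} (hx : φ x ≠ 0) : |x| ≤ radius φ := by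
  have h : φ ≠ 0 := by rintro rfl; exact hx rfl
  unfold radius
  rw [if_neg h]
  obtain ⟨A, -, hA⟩ := exists_support_bound φ
  refine le_csSup ⟨A, ?_⟩ ⟨x, hx, rfl⟩
  rintro _ ⟨y, hy, rfl⟩
  by_contra hlt
  exact hy (hA y (not_le.1 hlt))

/-- The directing sequence of sets of test functions (for `n ≥ 1`). -/
def directing (n : ℕ) : Set TestFn :=
  {φ | (∀ x, (φ x).im = 0) ∧
    (∀ x, φ (-x) = φ x) ∧
    radius φ ≤ 1 / (n : ℝ) ∧
    ∫ x, φ x = 1 ∧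
    (∀ k : ℕ, 1 ≤ k → k ≤ n → ∫ x : ℝ, (x : ℂ) ^ k * φ x = 0) ∧
    ∫ x, ‖φ x‖ ≤ 1 + 1 / (n : ℝ) ∧
    ∀ k : ℕ, k ≤ n → ∀ x, ‖iteratedDeriv k φ x‖ ≤ (radius φ)⁻¹ ^ (2 * (k + 1))}

theorem radius_pos {n : ℕ} {φ : TestFn} (h : φ ∈ directing n) : 0 < radius φ := by
  obtain ⟨-, -, -, h1, -, -, h2⟩ := h
  refine lt_of_le_of_ne (radius_nonneg φ) fun h0 => ?_
  have : ∀ x, φ x = 0 := fun x => by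
    have := h2 0 (Nat.zero_le _) x
    rw [← h0] at this
    simpa using this
  simp [this] at h1

end TestFunctions

/-- An ultrafilter on the set of test functions that contains every set of the directing
sequence. -/
structure DirectedUltrafilter where
  toUltrafilter : Ultrafilter TestFn
  mem_directing : ∀ n : ℕ, 1 ≤ n → directing n ∈ toUltrafilter

/-- `U.ae` is the filter of the sets of test functions on which a property holds almost
everywhere. -/
def DirectedUltrafilter.ae (U : DirectedUltrafilter) : Filter TestFn := U.toUltrafilter

/-! ### Estimates for distributions -/

section Estimates

/-- A distribution has finite order on every compact set. -/
theorem bound (T : Dist) (A : ℝ) : ∃ N : ℕ, ∃ C : ℝ, 0 ≤ C ∧ ∀ ψ : TestFn,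
    (∀ x, A < |x| → ψ x = 0) → ∀ B : ℝ, 0 ≤ B →
      (∀ j ≤ N, ∀ x, ‖iteratedDeriv j ψ x‖ ≤ B) → ‖T ψ‖ ≤ C * B := by
  let K : TopologicalSpace.Compacts ℝ := ⟨Set.Icc (-A) A, isCompact_Icc⟩
  have hK : (K : Set ℝ) ⊆ (⊤ : TopologicalSpace.Opens ℝ) := Set.subset_univ _
  let L := T.comp (TestFunction.ofSupportedInCLM (n := ⊤) (F := ℂ) ℂ hK)
  let q : Seminorm ℂ (ContDiffMapSupportedIn ℝ ℂ ⊤ K) := (normSeminorm ℂ ℂ).comp L.toLinearMap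
  have hq : Continuous q := continuous_norm.comp L.continuous
  obtain ⟨s, C, -, hC⟩ := Seminorm.bound_of_continuous
    (ContDiffMapSupportedIn.withSeminorms ℂ ℝ ℂ ⊤ K) q hq
  refine ⟨s.sup id, C, C.2, fun ψ hψ B hB h => ?_⟩
  have hs : Function.support ψ ⊆ K := fun x hx => by
    by_contra hx'
    refine hx (hψ x ?_)
    by_contra h'
    exact hx' (abs_le.1 (not_lt.1 h'))
  let ψ' : ContDiffMapSupportedIn ℝ ℂ ⊤ K :=
    ContDiffMapSupportedIn.of_support_subset (smooth ψ) hs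
  have h1 : q ψ' = ‖T ψ‖ := rfl
  rw [← h1]
  refine (hC ψ').trans ?_
  change (C : ℝ) * _ ≤ _
  refine mul_le_mul_of_nonneg_left ?_ C.2
  refine Seminorm.finset_sup_apply_le hB fun j hj => ?_
  rw [ContDiffMapSupportedIn.seminorm_top_le_iff ℂ hB]
  intro x _
  rw [norm_iteratedFDeriv_eq_norm_iteratedDeriv]
  exact h j (Finset.le_sup (f := id) hj) x

/-- The convolution `T ⋆ φ` of a distribution and a test function. -/
noncomputable def convTest (T : Dist) (φ : TestFn) (x : ℝ) : ℂ := T (shift φ x)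

theorem iteratedDeriv_shift (φ : TestFn) (x : ℝ) (j : ℕ) (y : ℝ) :
    iteratedDeriv j (shift φ x) y = (-1) ^ j * iteratedDeriv j φ (x - y) := by
  have : ⇑(shift φ x) = fun y => φ (x - y) := rfl
  rw [this, iteratedDeriv_comp_const_sub]
  simp

theorem second_order (f : ℝ → ℂ) (hf : ContDiff ℝ ∞ f) (C : ℝ)
    (hC : ∀ x, ‖iteratedDeriv 2 f x‖ ≤ C) (x h : ℝ) :
    ‖f (x + h) - f x - h * deriv f x‖ ≤ C * |h| ^ 2 := by
  have hd : Differentiable ℝ f := hf.differentiable (by simp)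
  have hf' : ContDiff ℝ ∞ (deriv f) := (contDiff_infty_iff_deriv.1 hf).2
  have hd' : Differentiable ℝ (deriv f) := hf'.differentiable (by simp)
  have h2 : ∀ u, ‖deriv (deriv f) u‖ ≤ C := fun u => by
    have := hC u
    rwa [iteratedDeriv_succ, iteratedDeriv_one] at this
  have h1 : ∀ u v, ‖deriv f u - deriv f v‖ ≤ C * |u - v| := fun u v => by
    have := Convex.norm_image_sub_le_of_norm_deriv_le (𝕜 := ℝ) (f := deriv f) (s := Set.univ)
      (fun z _ => hd' z) (fun z _ => h2 z) convex_univ (Set.mem_univ v) (Set.mem_univ u)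
    simpa using this
  have hC0 : 0 ≤ C := (norm_nonneg _).trans (hC 0)
  let F : ℝ → ℂ := fun u => f u - (u : ℂ) * deriv f x
  have hF : ∀ u, HasDerivAt F (deriv f u - deriv f x) u := fun u => by
    have := (hd u).hasDerivAt.sub ((Complex.ofRealCLM.hasDerivAt (x := u)).mul_const (deriv f x))
    simpa [F] using! this
  have := Convex.norm_image_sub_le_of_norm_hasDerivWithin_le (𝕜 := ℝ) (f := F)
    (s := Metric.closedBall x |h|) (C := C * |h|) (x := x) (y := x + h)
    (fun z _ => (hF z).hasDerivWithinAt)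
    (fun z hz => (h1 z x).trans (by
      rw [Metric.mem_closedBall, Real.dist_eq] at hz
      gcongr))
    (convex_closedBall _ _) (by simp) (by simp)
  calc ‖f (x + h) - f x - h * deriv f x‖ = ‖F (x + h) - F x‖ := by
        simp only [F]; congr 1; push_cast; ring
    _ ≤ C * |h| * ‖x + h - x‖ := this
    _ = C * |h| ^ 2 := by rw [add_sub_cancel_left, Real.norm_eq_abs]; ring

theorem hasDerivAt_convTest (T : Dist) (φ : TestFn) (x : ℝ) :
    HasDerivAt (convTest T φ) (convTest T (derivTest φ) x) x := by
  obtain ⟨A, hA0, hA⟩ := exists_support_bound φ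
  obtain ⟨N, C, hC, hb⟩ := bound T (A + |x| + 1)
  choose D hD0 hD using fun j => iteratedDeriv_bounded φ (j + 2)
  let B : ℝ := ∑ j ∈ Finset.range (N + 1), D j
  have hB : 0 ≤ B := Finset.sum_nonneg fun j _ => hD0 j
  have hDB : ∀ j ≤ N, D j ≤ B := fun j hj =>
    Finset.single_le_sum (f := D) (fun i _ => hD0 i) (Finset.mem_range.2 (by omega))
  rw [hasDerivAt_iff_isLittleO_nhds_zero]
  have key : ∀ h : ℝ, |h| ≤ 1 → ‖convTest T φ (x + h) - convTest T φ x
      - h • convTest T (derivTest φ) x‖ ≤ C * B * |h| ^ 2 := by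
    intro h hh
    have e : convTest T φ (x + h) - convTest T φ x - h • convTest T (derivTest φ) x
        = T (shift φ (x + h) - shift φ x - (h : ℂ) • shift (derivTest φ) x) := by
      simp only [convTest, map_sub, map_smul]; rfl
    rw [e, mul_assoc]
    refine hb _ ?_ _ (by positivity) ?_
    · intro y hy
      have h1 : φ (x + h - y) = 0 := hA _ (by
        have := abs_sub_abs_le_abs_sub y (x + h)
        have := abs_add_le x h
        rw [abs_sub_comm]; linarith)
      have h2 : ∀ᶠ z in nhds (x - y), φ z = 0 := by
        have hz : A < |x - y| := by
          have := abs_sub_abs_le_abs_sub y x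
          rw [abs_sub_comm]; linarith
        filter_upwards [continuous_abs.continuousAt.eventually (lt_mem_nhds hz)] with z hz'
        exact hA z hz'
      have h3 : deriv φ (x - y) = 0 := by
        have : ⇑φ =ᶠ[nhds (x - y)] fun _ => 0 := h2
        rw [this.deriv_eq]; simp
      simp [h1, h3, h2.self_of_nhds]
    · intro j hj y
      have e1 : iteratedDeriv j
          ⇑(shift φ (x + h) - shift φ x - (h : ℂ) • shift (derivTest φ) x) y
          = (-1) ^ j * (iteratedDeriv j φ (x - y + h) - iteratedDeriv j φ (x - y)
            - h * deriv (iteratedDeriv j φ) (x - y)) := by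
        have c : ∀ ψ : TestFn, ContDiffAt ℝ j ψ y := fun ψ =>
          ((smooth ψ).of_le (by exact_mod_cast le_top)).contDiffAt
        have e0 : ⇑(shift φ (x + h) - shift φ x - (h : ℂ) • shift (derivTest φ) x)
          = ⇑(shift φ (x + h)) - ⇑(shift φ x) - (h : ℂ) • ⇑(shift (derivTest φ) x) := rfl
        have cs : ContDiffAt ℝ j (⇑(shift φ (x + h)) - ⇑(shift φ x)) y := (c _).sub (c _)
        have cd : ContDiffAt ℝ j ((h : ℂ) • ⇑(shift (derivTest φ) x)) y :=
          contDiffAt_const.smul (c (shift (derivTest φ) x))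
        rw [e0, iteratedDeriv_sub cs cd,
          iteratedDeriv_sub (c _) (c _), iteratedDeriv_const_smul (c _)]
        simp only [iteratedDeriv_shift]
        have : iteratedDeriv j (derivTest φ) = deriv (iteratedDeriv j φ) := by
          rw [← iteratedDeriv_succ, iteratedDeriv_succ']; rfl
        rw [this, show x + h - y = x - y + h by ring, smul_eq_mul]
        ring
      rw [e1, norm_mul, norm_pow, norm_neg, norm_one, one_pow, one_mul]
      have hsm : ContDiff ℝ ∞ (iteratedDeriv j φ) := by
        rw [← coe_derivTest_iterate]; exact smooth _
      refine (second_order _ hsm (D j) (fun z => ?_) _ _).trans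
        (mul_le_mul_of_nonneg_right (hDB j hj) (by positivity))
      have : iteratedDeriv 2 (iteratedDeriv j φ) = iteratedDeriv (j + 2) φ := by
        simp only [iteratedDeriv_eq_iterate, ← Function.iterate_add_apply, add_comm]
      rw [this]
      exact hD j z
  rw [Asymptotics.isLittleO_iff]
  intro c hc
  have hpos : 0 < c / (C * B + 1) := by positivity
  filter_upwards [Metric.ball_mem_nhds (0 : ℝ) (lt_min one_pos hpos)] with h hh
  rw [Metric.mem_ball, dist_zero_right, Real.norm_eq_abs, lt_min_iff] at hh
  refine (key h hh.1.le).trans ?_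
  have h1 : (C * B + 1) * |h| ≤ c := by
    have := hh.2.le
    rwa [le_div_iff₀ (by positivity), mul_comm] at this
  rw [Real.norm_eq_abs]
  nlinarith [abs_nonneg h]

theorem iteratedDeriv_convTest (T : Dist) (φ : TestFn) (k : ℕ) :
    iteratedDeriv k (convTest T φ) = convTest T (derivTest^[k] φ) := by
  induction k generalizing φ with
  | zero => simp
  | succ k ih =>
    rw [iteratedDeriv_succ', Function.iterate_succ_apply, ← ih]
    congr 1
    ext x
    exact (hasDerivAt_convTest T φ x).deriv

theorem contDiff_convTest (T : Dist) (φ : TestFn) : ContDiff ℝ ∞ (convTest T φ) := by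
  refine contDiff_of_differentiable_iteratedDeriv (n := ⊤) fun m _ => ?_
  rw [iteratedDeriv_convTest]
  exact fun x => (hasDerivAt_convTest T _ x).differentiableAt

theorem convTest_add (T : Dist) (φ ψ : TestFn) (x : ℝ) :
    convTest T (φ + ψ) x = convTest T φ x + convTest T ψ x := by
  rw [convTest, show shift (φ + ψ) x = shift φ x + shift ψ x from rfl, map_add]; rfl

theorem convTest_smul (T : Dist) (c : ℂ) (φ : TestFn) (x : ℝ) :
    convTest T (c • φ) x = c * convTest T φ x := by
  rw [convTest, show shift (c • φ) x = c • shift φ x from rfl, map_smul]; rfl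

/-- Estimate of `T ⋆ φ` on a bounded set. -/
theorem bound_convTest (T : Dist) (A M : ℝ) : ∃ N : ℕ, ∃ C : ℝ, 0 ≤ C ∧ ∀ φ : TestFn,
    (∀ x, A < |x| → φ x = 0) → ∀ B : ℝ, 0 ≤ B →
      (∀ j ≤ N, ∀ x, ‖iteratedDeriv j φ x‖ ≤ B) → ∀ x, |x| ≤ M → ‖convTest T φ x‖ ≤ C * B := by
  obtain ⟨N, C, hC, hb⟩ := bound T (A + M)
  refine ⟨N, C, hC, fun φ hφ B hB h x hx => hb _ (fun y hy => ?_) B hB fun j hj y => ?_⟩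
  · rw [shift_apply]
    refine hφ _ ?_
    have := abs_sub_abs_le_abs_sub y x
    rw [abs_sub_comm]; linarith
  · rw [iteratedDeriv_shift, norm_mul, norm_pow, norm_neg, norm_one, one_pow, one_mul]
    exact h j hj _

end Estimates

/-! ### Moderate and negligible nets -/

section Asymptotics

variable {ι κ : Type*} (U : DirectedUltrafilter)

/-- A net of families of real numbers is moderate if it is uniformly bounded by a negative power
of the radius of support, almost everywhere. -/
def IsMod (S : Set ι) (u : TestFn → ι → ℝ) : Prop :=
  ∃ m : ℕ, ∀ᶠ φ in U.ae, ∀ x ∈ S, u φ x ≤ (radius φ)⁻¹ ^ m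

/-- A net of families of real numbers is negligible if it is uniformly bounded by every power
of the radius of support, almost everywhere. -/
def IsNeg (S : Set ι) (u : TestFn → ι → ℝ) : Prop :=
  ∀ p : ℕ, ∀ᶠ φ in U.ae, ∀ x ∈ S, u φ x ≤ radius φ ^ p

variable {U} {S : Set ι} {u v w : TestFn → ι → ℝ}

theorem eventually_directing {n : ℕ} (hn : 1 ≤ n) : ∀ᶠ φ in U.ae, φ ∈ directing n :=
  U.mem_directing n hn

theorem eventually_radius_le {ε : ℝ} (hε : 0 < ε) :
    ∀ᶠ φ in U.ae, 0 < radius φ ∧ radius φ ≤ ε := by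
  obtain ⟨n, hn⟩ := exists_nat_one_div_lt hε
  filter_upwards [eventually_directing (U := U) (n := n + 1) (by omega)] with φ hφ
  refine ⟨radius_pos hφ, hφ.2.2.1.trans ?_⟩
  push_cast
  exact hn.le

theorem eventually_le_inv (C : ℝ) : ∀ᶠ φ in U.ae, C ≤ (radius φ)⁻¹ := by
  filter_upwards [eventually_radius_le (U := U) (ε := (max C 1)⁻¹) (by positivity)] with φ hφ
  refine (le_max_left C 1).trans ?_
  rw [← inv_inv (max C 1)]
  exact inv_anti₀ hφ.1 hφ.2

theorem IsMod.mono (hv : IsMod U S v) (h : ∀ᶠ φ in U.ae, ∀ x ∈ S, u φ x ≤ v φ x) :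
    IsMod U S u := by
  obtain ⟨m, hm⟩ := hv
  exact ⟨m, by filter_upwards [hm, h] with φ h1 h2 x hx using (h2 x hx).trans (h1 x hx)⟩

theorem IsNeg.mono (hv : IsNeg U S v) (h : ∀ᶠ φ in U.ae, ∀ x ∈ S, u φ x ≤ v φ x) :
    IsNeg U S u := fun p => by
  filter_upwards [hv p, h] with φ h1 h2 x hx using (h2 x hx).trans (h1 x hx)

theorem isMod_const (C : ℝ) : IsMod U S fun _ _ => C :=
  ⟨1, by filter_upwards [eventually_le_inv (U := U) C] with φ h x _ using by simpa using h⟩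

theorem isNeg_zero : IsNeg U S fun _ _ => 0 := fun _ =>
  Filter.Eventually.of_forall fun φ _ _ => pow_nonneg (radius_nonneg φ) _

theorem IsMod.mul (hu : IsMod U S u) (hv : IsMod U S v) (h0 : ∀ φ x, 0 ≤ v φ x) :
    IsMod U S fun φ x => u φ x * v φ x := by
  obtain ⟨m, hm⟩ := hu
  obtain ⟨n, hn⟩ := hv
  refine ⟨m + n, ?_⟩
  filter_upwards [hm, hn] with φ h1 h2 x hx
  rw [pow_add]
  exact mul_le_mul (h1 x hx) (h2 x hx) (h0 φ x)
    (pow_nonneg (inv_nonneg.2 (radius_nonneg φ)) _)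

theorem IsMod.mul_isNeg (hu : IsMod U S u) (hv : IsNeg U S v) (h0 : ∀ φ x, 0 ≤ v φ x) :
    IsNeg U S fun φ x => u φ x * v φ x := fun p => by
  obtain ⟨m, hm⟩ := hu
  filter_upwards [hm, hv (m + p), eventually_radius_le (U := U) one_pos] with φ h1 h2 h3 x hx
  refine (mul_le_mul (h1 x hx) (h2 x hx) (h0 φ x)
    (pow_nonneg (inv_nonneg.2 (radius_nonneg φ)) _)).trans_eq ?_
  rw [pow_add, ← mul_assoc, ← mul_pow, inv_mul_cancel₀ h3.1.ne', one_pow, one_mul]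

theorem IsMod.add (hu : IsMod U S u) (hv : IsMod U S v) :
    IsMod U S fun φ x => u φ x + v φ x := by
  obtain ⟨m, hm⟩ := hu
  obtain ⟨n, hn⟩ := hv
  refine ⟨m + n + 1, ?_⟩
  filter_upwards [hm, hn, eventually_le_inv (U := U) 2] with φ h1 h2 h3 x hx
  have hr : 1 ≤ (radius φ)⁻¹ := by linarith
  have e1 := (h1 x hx).trans (pow_le_pow_right₀ hr (Nat.le_add_right m n))
  have e2 := (h2 x hx).trans (pow_le_pow_right₀ hr (Nat.le_add_left n m))
  rw [pow_succ]
  have : 0 ≤ (radius φ)⁻¹ ^ (m + n) := by positivity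
  nlinarith

theorem IsNeg.add (hu : IsNeg U S u) (hv : IsNeg U S v) :
    IsNeg U S fun φ x => u φ x + v φ x := fun p => by
  filter_upwards [hu (p + 1), hv (p + 1),
    eventually_radius_le (U := U) (ε := 1 / 2) (by norm_num)] with φ h1 h2 h3 x hx
  have e1 := h1 x hx
  have e2 := h2 x hx
  rw [pow_succ] at e1 e2
  have : 0 ≤ radius φ ^ p := pow_nonneg h3.1.le _
  nlinarith [h3.2]

theorem IsMod.sum {s : Finset κ} {f : κ → TestFn → ι → ℝ} (h : ∀ i ∈ s, IsMod U S (f i)) :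
    IsMod U S fun φ x => ∑ i ∈ s, f i φ x := by
  classical
  induction s using Finset.induction_on with
  | empty => simpa using isMod_const (U := U) (S := S) 0
  | insert a s ha ih =>
    simp only [Finset.sum_insert ha]
    exact (h a (Finset.mem_insert_self a s)).add
      (ih fun i hi => h i (Finset.mem_insert_of_mem hi))

theorem IsNeg.sum {s : Finset κ} {f : κ → TestFn → ι → ℝ} (h : ∀ i ∈ s, IsNeg U S (f i)) :
    IsNeg U S fun φ x => ∑ i ∈ s, f i φ x := by
  classical
  induction s using Finset.induction_on with
  | empty => simpa using isNeg_zero (U := U) (S := S)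
  | insert a s ha ih =>
    simp only [Finset.sum_insert ha]
    exact (h a (Finset.mem_insert_self a s)).add
      (ih fun i hi => h i (Finset.mem_insert_of_mem hi))

end Asymptotics

/-! ### The ring of generalized scalars -/

section Scalars

variable (U : DirectedUltrafilter)

/-- The moderate nets of complex numbers. -/
noncomputable def moderateC : Subalgebra ℂ (TestFn → ℂ) where
  carrier := {A | ∃ m : ℕ, ∀ᶠ φ in U.ae, ‖A φ‖ ≤ (radius φ)⁻¹ ^ m}
  mul_mem' {A B} hA hB := by
    have hA' : IsMod U (Set.univ : Set Unit) fun φ _ => ‖A φ‖ := by simpa [IsMod] using hA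
    have hB' : IsMod U (Set.univ : Set Unit) fun φ _ => ‖B φ‖ := by simpa [IsMod] using hB
    simpa [IsMod] using hA'.mul hB' fun _ _ => norm_nonneg _
  add_mem' {A B} hA hB := by
    have hA' : IsMod U (Set.univ : Set Unit) fun φ _ => ‖A φ‖ := by simpa [IsMod] using hA
    have hB' : IsMod U (Set.univ : Set Unit) fun φ _ => ‖B φ‖ := by simpa [IsMod] using hB
    have := (hA'.add hB').mono (u := fun φ _ => ‖A φ + B φ‖)
      (Filter.Eventually.of_forall fun φ _ _ => norm_add_le _ _)
    simpa [IsMod] using this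
  algebraMap_mem' c := by
    have := isMod_const (U := U) (S := (Set.univ : Set Unit)) ‖c‖
    simpa [IsMod] using this

/-- The negligible nets of complex numbers. -/
noncomputable def negligibleC : Ideal (moderateC U) where
  carrier := {A | ∀ p : ℕ, ∀ᶠ φ in U.ae, ‖A.1 φ‖ ≤ radius φ ^ p}
  zero_mem' p := Filter.Eventually.of_forall fun φ => by
    simpa using pow_nonneg (radius_nonneg φ) p
  add_mem' {A B} hA hB := by
    have hA' : IsNeg U (Set.univ : Set Unit) fun φ _ => ‖A.1 φ‖ := by simpa [IsNeg] using hA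
    have hB' : IsNeg U (Set.univ : Set Unit) fun φ _ => ‖B.1 φ‖ := by simpa [IsNeg] using hB
    have := (hA'.add hB').mono (u := fun φ _ => ‖A.1 φ + B.1 φ‖)
      (Filter.Eventually.of_forall fun φ _ _ => norm_add_le _ _)
    simpa [IsNeg] using this
  smul_mem' A B hB := by
    have hA : ∃ m : ℕ, ∀ᶠ φ in U.ae, ‖A.1 φ‖ ≤ (radius φ)⁻¹ ^ m := A.2
    have hA' : IsMod U (Set.univ : Set Unit) fun φ _ => ‖A.1 φ‖ := by simpa [IsMod] using hA
    have hB' : IsNeg U (Set.univ : Set Unit) fun φ _ => ‖B.1 φ‖ := by simpa [IsNeg] using hB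
    simpa [IsNeg] using hA'.mul_isNeg hB' fun _ _ => norm_nonneg _

/-- The generalized scalars: moderate nets of complex numbers modulo negligible ones. -/
def CHat : Type := moderateC U ⧸ negligibleC U

noncomputable instance : CommRing (CHat U) :=
  inferInstanceAs (CommRing (moderateC U ⧸ negligibleC U))

noncomputable instance : Algebra ℂ (CHat U) :=
  inferInstanceAs (Algebra ℂ (moderateC U ⧸ negligibleC U))

/-- The class of a moderate net of complex numbers. -/
noncomputable def CHat.mk : moderateC U →ₐ[ℂ] CHat U := Ideal.Quotient.mkₐ ℂ (negligibleC U)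

end Scalars

/-! ### The algebra of generalized functions -/

section Functions

variable (U : DirectedUltrafilter)

theorem ContDiff.at_nat {f : ℝ → ℂ} (hf : ContDiff ℝ ∞ f) (k : ℕ) (x : ℝ) :
    ContDiffAt ℝ k f x :=
  (hf.of_le (by exact_mod_cast le_top)).contDiffAt

theorem norm_iteratedDeriv_add_le {f g : ℝ → ℂ} (hf : ContDiff ℝ ∞ f) (hg : ContDiff ℝ ∞ g)
    (k : ℕ) (x : ℝ) :
    ‖iteratedDeriv k (f + g) x‖ ≤ ‖iteratedDeriv k f x‖ + ‖iteratedDeriv k g x‖ := by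
  rw [iteratedDeriv_add (ContDiff.at_nat hf k x) (ContDiff.at_nat hg k x)]
  exact norm_add_le _ _

theorem norm_iteratedDeriv_mul_le {f g : ℝ → ℂ} (hf : ContDiff ℝ ∞ f) (hg : ContDiff ℝ ∞ g)
    (k : ℕ) (x : ℝ) :
    ‖iteratedDeriv k (f * g) x‖ ≤ ∑ i ∈ Finset.range (k + 1),
      (k.choose i : ℝ) * ‖iteratedDeriv i f x‖ * ‖iteratedDeriv (k - i) g x‖ := by
  rw [iteratedDeriv_mul (ContDiff.at_nat hf k x) (ContDiff.at_nat hg k x)]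
  refine (norm_sum_le _ _).trans_eq (Finset.sum_congr rfl fun i _ => ?_)
  rw [norm_mul, norm_mul, Complex.norm_natCast]

/-- The moderate nets of smooth functions. -/
noncomputable def moderate : Subalgebra ℂ (TestFn → ℝ → ℂ) where
  carrier := {f | (∀ φ, ContDiff ℝ ∞ (f φ)) ∧
    ∀ K : Set ℝ, IsCompact K → ∀ k : ℕ, ∃ m : ℕ, ∀ᶠ φ in U.ae, ∀ x ∈ K,
      ‖iteratedDeriv k (f φ) x‖ ≤ (radius φ)⁻¹ ^ m}
  mul_mem' {f g} hf hg := ⟨fun φ => (hf.1 φ).mul (hg.1 φ), fun K hK k =>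
    IsMod.mono (IsMod.sum fun i _ =>
      (((isMod_const (k.choose i : ℝ)).mul (hf.2 K hK i) fun _ _ => norm_nonneg _).mul
        (hg.2 K hK (k - i)) fun _ _ => norm_nonneg _))
      (Filter.Eventually.of_forall fun φ x _ =>
        norm_iteratedDeriv_mul_le (hf.1 φ) (hg.1 φ) k x)⟩
  add_mem' {f g} hf hg := ⟨fun φ => (hf.1 φ).add (hg.1 φ), fun K hK k =>
    IsMod.mono (IsMod.add (hf.2 K hK k) (hg.2 K hK k))
      (Filter.Eventually.of_forall fun φ x _ =>
        norm_iteratedDeriv_add_le (hf.1 φ) (hg.1 φ) k x)⟩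
  algebraMap_mem' c := ⟨fun φ => contDiff_const (c := c), fun K hK k =>
    IsMod.mono (isMod_const ‖c‖) (Filter.Eventually.of_forall fun φ x _ => by
      change ‖iteratedDeriv k (fun _ : ℝ => c) x‖ ≤ _
      rw [iteratedDeriv_const]
      split_ifs <;> simp)⟩

/-- The negligible nets of smooth functions. -/
noncomputable def negligible : Ideal (moderate U) where
  carrier := {f | ∀ K : Set ℝ, IsCompact K → ∀ k p : ℕ, ∀ᶠ φ in U.ae, ∀ x ∈ K,
    ‖iteratedDeriv k (f.1 φ) x‖ ≤ radius φ ^ p}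
  zero_mem' K hK k := IsNeg.mono isNeg_zero (Filter.Eventually.of_forall fun φ x _ => by
    change ‖iteratedDeriv k (fun _ : ℝ => (0 : ℂ)) x‖ ≤ _
    simp)
  add_mem' {f g} hf hg K hK k :=
    IsNeg.mono (IsNeg.add (hf K hK k) (hg K hK k))
      (Filter.Eventually.of_forall fun φ x _ =>
        norm_iteratedDeriv_add_le (f.2.1 φ) (g.2.1 φ) k x)
  smul_mem' f g hg K hK k :=
    IsNeg.mono (IsNeg.sum fun i _ =>
      (((isMod_const (k.choose i : ℝ)).mul (f.2.2 K hK i) fun _ _ => norm_nonneg _).mul_isNeg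
        (hg K hK (k - i)) fun _ _ => norm_nonneg _))
      (Filter.Eventually.of_forall fun φ x _ =>
        norm_iteratedDeriv_mul_le (f.2.1 φ) (g.2.1 φ) k x)

/-- The generalized functions: moderate nets of smooth functions modulo negligible ones. -/
def EHat : Type := moderate U ⧸ negligible U

noncomputable instance : CommRing (EHat U) :=
  inferInstanceAs (CommRing (moderate U ⧸ negligible U))

noncomputable instance : Algebra ℂ (EHat U) :=
  inferInstanceAs (Algebra ℂ (moderate U ⧸ negligible U))

/-- The class of a moderate net of smooth functions. -/
noncomputable def EHat.mk : moderate U →ₐ[ℂ] EHat U := Ideal.Quotient.mkₐ ℂ (negligible U)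

variable {U}

theorem EHat.mk_eq_mk {f g : moderate U} :
    EHat.mk U f = EHat.mk U g ↔ f - g ∈ negligible U :=
  Ideal.Quotient.eq

theorem CHat.mk_eq_mk {A B : moderateC U} :
    CHat.mk U A = CHat.mk U B ↔ A - B ∈ negligibleC U :=
  Ideal.Quotient.eq

theorem EHat.mk_surjective : Function.Surjective (EHat.mk U) := Ideal.Quotient.mk_surjective

theorem CHat.mk_surjective : Function.Surjective (CHat.mk U) := Ideal.Quotient.mk_surjective

variable (U)

/-- The derivative of a moderate net. -/
noncomputable def derivNet : moderate U →ₗ[ℂ] moderate U where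
  toFun f := ⟨fun φ => _root_.deriv (f.1 φ),
    fun φ => (contDiff_infty_iff_deriv.1 (f.2.1 φ)).2, fun K hK k => by
    have := f.2.2 K hK (k + 1)
    simp only [iteratedDeriv_succ'] at this
    exact this⟩
  map_add' f g := by
    ext φ x
    exact deriv_add ((ContDiff.at_nat (f.2.1 φ) 1 x).differentiableAt (by simp))
      ((ContDiff.at_nat (g.2.1 φ) 1 x).differentiableAt (by simp))
  map_smul' c f := by
    ext φ x
    exact deriv_const_smul c ((ContDiff.at_nat (f.2.1 φ) 1 x).differentiableAt (by simp))

theorem derivNet_mem {f : moderate U} (hf : f ∈ negligible U) :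
    derivNet U f ∈ negligible U := fun K hK k p => by
  have := hf K hK (k + 1) p
  simp only [iteratedDeriv_succ'] at this
  exact this

/-- The derivative on the algebra of generalized functions, `(q(f_φ))' = q(f_φ')`. -/
noncomputable def EHat.deriv : EHat U →ₗ[ℂ] EHat U :=
  Submodule.mapQ ((negligible U).restrictScalars ℂ) ((negligible U).restrictScalars ℂ)
    (derivNet U) fun _ hf => derivNet_mem U hf

@[simp] theorem EHat.deriv_mk (f : moderate U) :
    EHat.deriv U (EHat.mk U f) = EHat.mk U (derivNet U f) := rfl

/-- The value of a moderate net at a point. -/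
noncomputable def evalNet (x : ℝ) : moderate U →ₐ[ℂ] moderateC U where
  toFun f := ⟨fun φ => f.1 φ x, by
    obtain ⟨m, hm⟩ := f.2.2 {x} isCompact_singleton 0
    exact ⟨m, by filter_upwards [hm] with φ h using by simpa using h⟩⟩
  map_zero' := rfl
  map_one' := rfl
  map_add' _ _ := rfl
  map_mul' _ _ := rfl
  commutes' _ := rfl

theorem evalNet_mem (x : ℝ) {f : moderate U} (hf : f ∈ negligible U) :
    evalNet U x f ∈ negligibleC U := fun p => by
  filter_upwards [hf {x} isCompact_singleton 0 p] with φ h using by simpa using! h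

/-- The value of a generalized function at a real point, `q(f_φ)(x) = q(f_φ(x))`. -/
noncomputable def EHat.eval (x : ℝ) : EHat U →ₐ[ℂ] CHat U :=
  Ideal.Quotient.liftₐ (negligible U) ((CHat.mk U).comp (evalNet U x)) fun _ hf =>
    Ideal.Quotient.eq_zero_iff_mem.2 (evalNet_mem U x hf)

@[simp] theorem EHat.eval_mk (x : ℝ) (f : moderate U) :
    EHat.eval U x (EHat.mk U f) = CHat.mk U (evalNet U x f) := rfl

/-- A moderate net of scalars as a moderate net of constant functions. -/
noncomputable def constNet : moderateC U →ₐ[ℂ] moderate U where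
  toFun A := ⟨fun φ _ => A.1 φ, fun _ => contDiff_const, fun K hK k => by
    obtain ⟨m, hm⟩ := A.2
    refine ⟨m, ?_⟩
    filter_upwards [hm] with φ h x _
    rw [iteratedDeriv_const]
    split_ifs
    · exact h
    · simpa using pow_nonneg (inv_nonneg.2 (radius_nonneg φ)) m⟩
  map_zero' := rfl
  map_one' := rfl
  map_add' _ _ := rfl
  map_mul' _ _ := rfl
  commutes' _ := rfl

theorem constNet_mem {A : moderateC U} (hA : A ∈ negligibleC U) :
    constNet U A ∈ negligible U := fun K hK k p => by
  filter_upwards [hA p] with φ h x _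
  change ‖iteratedDeriv k (fun _ : ℝ => A.1 φ) x‖ ≤ _
  rw [iteratedDeriv_const]
  split_ifs
  · exact h
  · simpa using pow_nonneg (radius_nonneg φ) p

/-- Generalized scalars as constant generalized functions. -/
noncomputable def EHat.const : CHat U →ₐ[ℂ] EHat U :=
  Ideal.Quotient.liftₐ (negligibleC U) ((EHat.mk U).comp (constNet U)) fun _ hf =>
    Ideal.Quotient.eq_zero_iff_mem.2 (constNet_mem U hf)

@[simp] theorem EHat.const_mk (A : moderateC U) :
    EHat.const U (CHat.mk U A) = EHat.mk U (constNet U A) := rfl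

noncomputable instance : Algebra (CHat U) (EHat U) := (EHat.const U).toRingHom.toAlgebra

theorem EHat.smul_def (c : CHat U) (f : EHat U) : c • f = EHat.const U c * f := rfl

/-- The net `T ⋆ φ` is moderate. -/
noncomputable def iotaNet (T : Dist) : moderate U :=
  ⟨fun φ => convTest T φ, fun φ => contDiff_convTest T φ, fun K hK k => by
    obtain ⟨M, hM⟩ := hK.isBounded.subset_closedBall 0
    obtain ⟨N, C, hC, hb⟩ := bound_convTest T 1 M
    refine ⟨2 * (N + k + 1) + 1, ?_⟩
    filter_upwards [eventually_directing (U := U) (n := N + k + 1) (by omega),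
      eventually_le_inv (U := U) C, eventually_radius_le (U := U) one_pos] with φ h1 h2 h3 x hx
    have hr : 1 ≤ (radius φ)⁻¹ := (one_le_inv₀ h3.1).2 h3.2
    have hx' : |x| ≤ M := by simpa using hM hx
    change ‖iteratedDeriv k (convTest T φ) x‖ ≤ _
    rw [iteratedDeriv_convTest, pow_succ, mul_comm]
    refine (hb (derivTest^[k] φ) (fun y hy => ?_) ((radius φ)⁻¹ ^ (2 * (N + k + 1)))
      (by positivity) (fun j hj y => ?_) x hx').trans (by gcongr)
    · rw [coe_derivTest_iterate]
      have hev : ∀ᶠ z in nhds y, φ z = 0 := by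
        filter_upwards [continuous_abs.continuousAt.eventually (lt_mem_nhds hy)] with z hz
        by_contra h0
        exact absurd ((abs_le_radius h0).trans h3.2) (not_le.2 hz)
      have : ⇑φ =ᶠ[nhds y] fun _ => 0 := hev
      rw [this.iteratedDeriv_eq]
      simp
    · have e : iteratedDeriv j ⇑(derivTest^[k] φ) = iteratedDeriv (j + k) φ := by
        rw [← coe_derivTest_iterate, ← Function.iterate_add_apply, coe_derivTest_iterate]
      rw [e]
      exact (h1.2.2.2.2.2.2 (j + k) (by omega) y).trans (pow_le_pow_right₀ hr (by omega))⟩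

/-- The canonical embedding of distributions, `ι(T) = q(T ⋆ φ)`. -/
noncomputable def iota (T : Dist) : EHat U := EHat.mk U (iotaNet U T)

end Functions

/-! ### Distributions supported by the half-line and their convolution -/

section Convolution

/-- The distributions supported by `[0, ∞)`. -/
def DPlus : Submodule ℂ Dist where
  carrier := {T | Distribution.IsVanishingOn T (Set.Iio (0 : ℝ))}
  zero_mem' _ _ := rfl
  add_mem' {T S} hT hS ψ hψ := by
    rw [add_apply, hT ψ hψ, hS ψ hψ, add_zero]
  smul_mem' c T hT ψ hψ := by
    rw [smul_apply, hT ψ hψ, smul_zero]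

theorem convTest_eq_zero (S : DPlus) (φ : TestFn) {B x : ℝ} (hφ : ∀ z < B, φ z = 0)
    (hx : x < B) : convTest S.1 φ x = 0 := by
  refine S.2 _ ?_
  have h1 : Function.support (shift φ x) ⊆ Set.Iic (x - B) := fun y hy => by
    by_contra h
    refine hy (hφ _ ?_)
    rw [Set.mem_Iic, not_le] at h
    linarith
  exact (closure_minimal h1 isClosed_Iic).trans fun y hy => by
    have : y ≤ x - B := hy
    exact Set.mem_Iio.2 (by linarith)

/-- A smooth cutoff: it is `1` on `[-1, ∞)` and `0` on `(-∞, -2]`. -/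
noncomputable def cutoff (x : ℝ) : ℂ := (Real.smoothTransition (x + 2) : ℝ)

theorem contDiff_cutoff : ContDiff ℝ ∞ cutoff :=
  Complex.ofRealCLM.contDiff.comp
    (Real.smoothTransition.contDiff.comp (contDiff_id.add contDiff_const))

theorem cutoff_of_le {x : ℝ} (h : x ≤ -2) : cutoff x = 0 := by
  simp [cutoff, Real.smoothTransition.zero_of_nonpos (show x + 2 ≤ 0 by linarith)]

theorem bound_mul (T : Dist) {χ : ℝ → ℂ} (hχ : ContDiff ℝ ∞ χ) (A : ℝ) :
    ∃ N : ℕ, ∃ C : ℝ, 0 ≤ C ∧ ∀ (ψ : TestFn) (G : ℝ → ℂ), ContDiff ℝ ∞ G →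
      (∀ x, ψ x = χ x * G x) → (∀ x, A < |x| → ψ x = 0) → ∀ B : ℝ, 0 ≤ B →
      (∀ j ≤ N, ∀ x, |x| ≤ A → ‖iteratedDeriv j G x‖ ≤ B) → ‖T ψ‖ ≤ C * B := by
  obtain ⟨N, C, hC, hb⟩ := bound T A
  have h1 : ∀ i : ℕ, ∃ D, 0 ≤ D ∧ ∀ x, |x| ≤ A → ‖iteratedDeriv i χ x‖ ≤ D := fun i => by
    obtain ⟨D, hD⟩ := (isCompact_Icc (a := -A) (b := A)).exists_bound_of_continuousOn
      (hχ.continuous_iteratedDeriv i (by exact_mod_cast le_top)).continuousOn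
    exact ⟨max D 0, le_max_right _ _, fun x hx => (hD x (abs_le.1 hx)).trans (le_max_left _ _)⟩
  choose D hD0 hD using h1
  let E : ℝ := ∑ j ∈ Finset.range (N + 1), ∑ i ∈ Finset.range (j + 1), (j.choose i : ℝ) * D i
  have hj0 : ∀ j : ℕ, 0 ≤ ∑ i ∈ Finset.range (j + 1), (j.choose i : ℝ) * D i := fun j =>
    Finset.sum_nonneg fun i _ => mul_nonneg (Nat.cast_nonneg _) (hD0 i)
  have hE : 0 ≤ E := Finset.sum_nonneg fun j _ => hj0 j
  refine ⟨N, C * E, mul_nonneg hC hE, fun ψ G hG hψ hA B hB h => ?_⟩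
  rw [mul_assoc]
  refine hb ψ hA _ (mul_nonneg hE hB) fun j hj x => ?_
  by_cases hx : |x| ≤ A
  · have e : ⇑ψ = χ * G := funext hψ
    rw [e]
    refine (norm_iteratedDeriv_mul_le hχ hG j x).trans ?_
    calc _ ≤ ∑ i ∈ Finset.range (j + 1), (j.choose i : ℝ) * D i * B := by
          refine Finset.sum_le_sum fun i _ => ?_
          have := hD i x hx
          have := h (j - i) (by omega) x hx
          have := hD0 i
          gcongr
      _ = (∑ i ∈ Finset.range (j + 1), (j.choose i : ℝ) * D i) * B := by rw [Finset.sum_mul]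
      _ ≤ E * B := by
          refine mul_le_mul_of_nonneg_right ?_ hB
          exact Finset.single_le_sum (f := fun j => ∑ i ∈ Finset.range (j + 1),
            (j.choose i : ℝ) * D i) (fun j _ => hj0 j) (Finset.mem_range.2 (by omega))
  · have hev : ⇑ψ =ᶠ[nhds x] fun _ => 0 := by
      filter_upwards [continuous_abs.continuousAt.eventually (lt_mem_nhds (not_le.1 hx))]
        with z hz using hA z hz
    rw [hev.iteratedDeriv_eq]
    simpa using mul_nonneg hE hB

/-- For a distribution `S` supported by `[0, ∞)` and a test function `ψ`, the test function
`x ↦ η(x) S(y ↦ ψ(x + y))`, where `η` is a smooth cutoff that is `1` near `[0, ∞)`. The smooth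
function `x ↦ S(y ↦ ψ(x + y))` vanishes for large `x`. -/
noncomputable def pairing (S : DPlus) (ψ : TestFn) : TestFn :=
  mkTest (fun x => cutoff x * convTest S.1 (reflect ψ) (-x))
    (contDiff_cutoff.mul ((contDiff_convTest S.1 (reflect ψ)).comp contDiff_neg)) (by
      obtain ⟨A, hA0, hA⟩ := exists_support_bound ψ
      refine HasCompactSupport.intro (isCompact_Icc (a := -2) (b := A)) fun x hx => ?_
      by_cases h : x ≤ -2
      · rw [cutoff_of_le h, zero_mul]
      · have h2 : A < x := by
          by_contra h3
          exact hx ⟨(not_le.1 h).le, not_lt.1 h3⟩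
        rw [convTest_eq_zero S (reflect ψ) (B := -A) (fun z hz => ?_) (by linarith), mul_zero]
        exact hA _ (by rw [zero_sub]; exact lt_of_lt_of_le (by linarith) (le_abs_self _)))

/-- The value of `pairing`, in the usual notation. -/
theorem pairing_apply (S : DPlus) (ψ : TestFn) (x : ℝ) (ψx : TestFn)
    (h : ∀ y, ψx y = ψ (x + y)) : pairing S ψ x = cutoff x * S.1 ψx := by
  have : ψx = shift (reflect ψ) (-x) := by
    ext y
    rw [h, shift_apply, reflect, shift_apply]
    congr 1
    ring
  rw [this]
  rfl

theorem pairing_add (S : DPlus) (φ ψ : TestFn) :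
    pairing S (φ + ψ) = pairing S φ + pairing S ψ := by
  ext x
  change cutoff x * convTest S.1 (reflect φ + reflect ψ) (-x) = _
  rw [convTest_add, mul_add]
  rfl

theorem pairing_smul (S : DPlus) (c : ℂ) (ψ : TestFn) :
    pairing S (c • ψ) = c • pairing S ψ := by
  ext x
  change cutoff x * convTest S.1 (c • reflect ψ) (-x) =
    c * (cutoff x * convTest S.1 (reflect ψ) (-x))
  rw [convTest_smul]
  ring

theorem bound_pairing (T : Dist) (S : DPlus) (A : ℝ) (hA : 0 ≤ A) :
    ∃ N : ℕ, ∃ C : ℝ, 0 ≤ C ∧ ∀ ψ : TestFn,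
      (∀ x, A < |x| → ψ x = 0) → ∀ B : ℝ, 0 ≤ B →
        (∀ j ≤ N, ∀ x, ‖iteratedDeriv j ψ x‖ ≤ B) → ‖T (pairing S ψ)‖ ≤ C * B := by
  obtain ⟨N₁, C₁, hC₁, h₁⟩ := bound_mul T contDiff_cutoff (A + 2)
  obtain ⟨N₂, C₂, hC₂, h₂⟩ := bound_convTest S.1 A (A + 2)
  refine ⟨N₁ + N₂, C₁ * C₂, mul_nonneg hC₁ hC₂, fun ψ hψ B hB h => ?_⟩
  rw [mul_assoc]
  refine h₁ _ (fun x => convTest S.1 (reflect ψ) (-x))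
    ((contDiff_convTest S.1 (reflect ψ)).comp contDiff_neg) (fun x => rfl) (fun x hx => ?_) _
    (mul_nonneg hC₂ hB) fun k hk x hx => ?_
  · change cutoff x * convTest S.1 (reflect ψ) (-x) = 0
    by_cases h : x ≤ -2
    · rw [cutoff_of_le h, zero_mul]
    · have h2 : A < x := by
        rcases lt_abs.1 hx with h3 | h3 <;> linarith
      rw [convTest_eq_zero S (reflect ψ) (B := -A) (fun z hz => ?_) (by linarith), mul_zero]
      exact hψ _ (by rw [zero_sub]; exact lt_of_lt_of_le (by linarith) (le_abs_self _))
  · rw [iteratedDeriv_comp_neg, norm_smul, norm_pow, norm_neg, norm_one, one_pow, one_mul,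
      iteratedDeriv_convTest]
    refine h₂ _ (fun y hy => ?_) B hB (fun j hj y => ?_) _ (by rwa [abs_neg])
    · rw [coe_derivTest_iterate, reflect, iteratedDeriv_shift]
      have hev : ⇑ψ =ᶠ[nhds (0 - y)] fun _ => 0 := by
        have hy' : A < |0 - y| := by rwa [zero_sub, abs_neg]
        filter_upwards [continuous_abs.continuousAt.eventually (lt_mem_nhds hy')]
          with z hz using hψ z hz
      rw [hev.iteratedDeriv_eq]
      simp
    · rw [← coe_derivTest_iterate, ← Function.iterate_add_apply, coe_derivTest_iterate, reflect,
        iteratedDeriv_shift, norm_mul, norm_pow, norm_neg, norm_one, one_pow, one_mul]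
      exact h (j + k) (by omega) _

/-- The convolution of two distributions supported by `[0, ∞)`:
`(T ⋆ S)(ψ) = T_x (η(x) S_y (ψ(x + y)))`. -/
noncomputable def convDist (T S : DPlus) : DPlus :=
  ⟨TestFunction.mkCLM ℂ (fun ψ => T.1 (pairing S ψ))
    (fun φ ψ => by rw [pairing_add, map_add]) (fun c ψ => by rw [pairing_smul, map_smul])
    fun K hK => by
      obtain ⟨A, hA⟩ := K.isCompact.isBounded.subset_closedBall 0
      obtain ⟨N, C, hC, h⟩ := bound_pairing T.1 S (max A 0) (le_max_right _ _)
      refine (ContDiffMapSupportedIn.mkCLMtoNormedSpace ℂ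
        (fun ψ => T.1 (pairing S (TestFunction.ofSupportedIn hK ψ)))
        (fun φ ψ => ?_) (fun c ψ => ?_) ⟨Finset.range (N + 1), C, hC, fun ψ => ?_⟩).continuous
      · rw [← map_add, ← pairing_add]; rfl
      · rw [← map_smul, ← pairing_smul]; rfl
      · refine h _ (fun x hx => ψ.zero_on_compl fun hxK => ?_) _ (apply_nonneg _ _)
          fun j hj x => ?_
        · have := hA hxK
          rw [Metric.mem_closedBall, Real.dist_eq, sub_zero] at this
          exact absurd (this.trans (le_max_left _ _)) (not_le.2 hx)
        · rw [← norm_iteratedFDeriv_eq_norm_iteratedDeriv]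
          refine (ContDiffMapSupportedIn.norm_iteratedFDeriv_apply_le_seminorm_top ℂ).trans
            (Seminorm.le_finset_sup_apply
              (p := ContDiffMapSupportedIn.seminorm ℂ ℝ ℂ ⊤ K) (x := ψ)
              (Finset.mem_range.2 (by omega))),
  fun ψ hψ => by
    refine T.2 (pairing S ψ) ?_
    rcases (tsupport ψ).eq_empty_or_nonempty with he | hne
    · have h0 : ψ = 0 := by
        ext x
        exact image_eq_zero_of_notMem_tsupport (by simp [he])
      have : pairing S ψ = 0 := by
        have := pairing_smul S 0 ψ
        rw [zero_smul, zero_smul] at this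
        rw [h0, this]
      rw [this, show tsupport ⇑(0 : TestFn) = ∅ from tsupport_eq_empty_iff.2 rfl]
      exact Set.empty_subset _
    · obtain ⟨B, hB, hmax⟩ := ψ.hasCompactSupport.isCompact.exists_isGreatest hne
      have hB0 : B < 0 := hψ hB
      have h1 : Function.support (pairing S ψ) ⊆ Set.Iic B := fun x hx => by
        by_contra h
        refine hx ?_
        change cutoff x * convTest S.1 (reflect ψ) (-x) = 0
        rw [convTest_eq_zero S (reflect ψ) (B := -B) (fun z hz => ?_)
          (neg_lt_neg (not_le.1 h)), mul_zero]
        change ψ (0 - z) = 0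
        refine image_eq_zero_of_notMem_tsupport fun hz' => ?_
        have := hmax hz'
        linarith
      exact (closure_minimal h1 isClosed_Iic).trans fun x hx => lt_of_le_of_lt hx hB0⟩

theorem convDist_apply (T S : DPlus) (ψ : TestFn) :
    (convDist T S).1 ψ = T.1 (pairing S ψ) := rfl

end Convolution

/-! ### The span of the distributions supported by the half-line -/

section Span

variable (U : DirectedUltrafilter)

/-- The span, over the generalized scalars, of the image under `ι` of a set of distributions. -/
noncomputable def hatSpan (S : Set Dist) : Submodule (CHat U) (EHat U) :=
  Submodule.span (CHat U) (iota U '' S)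

/-- The linear combinations `∑ α_n ι(T_n)`. -/
noncomputable def combination : (DPlus →₀ CHat U) →ₗ[CHat U] EHat U :=
  Finsupp.linearCombination (CHat U) fun S : DPlus => iota U S.1

/-- The linear combinations `∑ α_n ι(T ⋆ T_n)`. -/
noncomputable def combinationConv (T : DPlus) : (DPlus →₀ CHat U) →ₗ[CHat U] EHat U :=
  Finsupp.linearCombination (CHat U) fun S : DPlus => iota U (convDist T S).1

theorem range_combination : (combination U).range = hatSpan U DPlus := by
  rw [combination, Finsupp.range_linearCombination, hatSpan]
  congr 1
  ext y
  simp

/-- A finite sum `∑ a_φ (T ⋆ φ)` as a net. -/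
theorem iteratedDeriv_sum_net (s : Finset DPlus) (a : DPlus → ℂ) (f : DPlus → Dist)
    (φ : TestFn) (k : ℕ) (x : ℝ) :
    iteratedDeriv k (fun x => ∑ S ∈ s, a S * convTest (f S) φ x) x =
      ∑ S ∈ s, a S * convTest (f S) (derivTest^[k] φ) x := by
  rw [iteratedDeriv_fun_sum fun S _ =>
    contDiffAt_const.mul (ContDiff.at_nat (contDiff_convTest (f S) φ) k x)]
  refine Finset.sum_congr rfl fun S _ => ?_
  rw [iteratedDeriv_const_mul_field, iteratedDeriv_convTest]

theorem pairing_shift (S : DPlus) (φ : TestFn) (x z : ℝ) :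
    pairing S (shift φ x) z = cutoff z * convTest S.1 φ (x - z) := by
  refine pairing_apply S _ z (shift φ (x - z)) fun y => ?_
  simp only [shift_apply]
  congr 1
  ring

/-- The convolution on the span is well defined. -/
theorem ker_le (T : DPlus) : (combination U).ker ≤ (combinationConv U T).ker := by
  intro c hc
  rw [LinearMap.mem_ker] at hc ⊢
  let a : DPlus → moderateC U := fun S => Function.surjInv CHat.mk_surjective (c S)
  have ha : ∀ S, CHat.mk U (a S) = c S := fun S => Function.surjInv_eq _ _
  have main : ∀ f : DPlus → Dist,
      Finsupp.linearCombination (CHat U) (fun S => iota U (f S)) c =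
        EHat.mk U (∑ S ∈ c.support, constNet U (a S) * iotaNet U (f S)) := fun f => by
    rw [Finsupp.linearCombination_apply, Finsupp.sum, map_sum]
    refine Finset.sum_congr rfl fun S _ => ?_
    rw [map_mul, EHat.smul_def, ← ha S, EHat.const_mk]
    rfl
  have coe : ∀ (f : DPlus → Dist) (φ : TestFn),
      (∑ S ∈ c.support, constNet U (a S) * iotaNet U (f S)).1 φ =
        fun x => ∑ S ∈ c.support, (a S).1 φ * convTest (f S) φ x := fun f φ => by
    ext x
    have h1 : (∑ S ∈ c.support, constNet U (a S) * iotaNet U (f S)).1 =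
        ∑ S ∈ c.support, (constNet U (a S) * iotaNet U (f S)).1 :=
      map_sum (moderate U).val _ _
    rw [h1, Finset.sum_apply, Finset.sum_apply]
    rfl
  have hF : ∑ S ∈ c.support, constNet U (a S) * iotaNet U S.1 ∈ negligible U := by
    rw [combination, main fun S => S.1] at hc
    exact Ideal.Quotient.eq_zero_iff_mem.1 hc
  rw [combinationConv, main fun S => (convDist T S).1]
  refine Ideal.Quotient.eq_zero_iff_mem.2 fun K hK k p => ?_
  obtain ⟨M₀, hM₀⟩ := hK.isBounded.subset_closedBall 0
  let M := max M₀ 0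
  have hM : ∀ x ∈ K, |x| ≤ M := fun x hx => by
    have := hM₀ hx
    rw [Metric.mem_closedBall, Real.dist_eq, sub_zero] at this
    exact this.trans (le_max_left _ _)
  have hM0 : 0 ≤ M := le_max_right _ _
  obtain ⟨N, C, hC, hb⟩ := bound_mul T.1 contDiff_cutoff (M + 2)
  have hF' : ∀ᶠ φ in U.ae, ∀ j ≤ N, ∀ x ∈ Set.Icc (-(2 * M + 2)) (2 * M + 2),
      ‖iteratedDeriv (k + j) (fun x => ∑ S ∈ c.support, (a S).1 φ * convTest S.1 φ x) x‖
        ≤ radius φ ^ (p + 1) := by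
    have : ∀ j ∈ Finset.range (N + 1), ∀ᶠ φ in U.ae,
        ∀ x ∈ Set.Icc (-(2 * M + 2)) (2 * M + 2),
        ‖iteratedDeriv (k + j) (fun x => ∑ S ∈ c.support, (a S).1 φ * convTest S.1 φ x) x‖
          ≤ radius φ ^ (p + 1) := fun j _ => by
      filter_upwards [hF _ isCompact_Icc (k + j) (p + 1)] with φ hφ x hx
      have := hφ x hx
      rwa [coe] at this
    filter_upwards [(Filter.eventually_all_finset _).2 this] with φ hφ j hj
    exact hφ j (Finset.mem_range.2 (by omega))
  filter_upwards [hF', eventually_le_inv (U := U) C,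
    eventually_radius_le (U := U) one_pos] with φ h1 h2 h3 x hx
  rw [coe, iteratedDeriv_sum_net]
  let ψ : TestFn := ∑ S ∈ c.support, (a S).1 φ • pairing S (shift (derivTest^[k] φ) x)
  let F : ℝ → ℂ := fun x => ∑ S ∈ c.support, (a S).1 φ * convTest S.1 (derivTest^[k] φ) x
  have hψ : ∀ z, ψ z = cutoff z * F (x - z) := fun z => by
    have e : ψ z = ∑ S ∈ c.support, (a S).1 φ * pairing S (shift (derivTest^[k] φ) x) z := by
      have : ∀ s : Finset DPlus, (∑ S ∈ s, (a S).1 φ • pairing S (shift (derivTest^[k] φ) x)) z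
          = ∑ S ∈ s, (a S).1 φ * pairing S (shift (derivTest^[k] φ) x) z := fun s => by
        classical
        induction s using Finset.induction_on with
        | empty => rfl
        | insert b s hb ih => rw [Finset.sum_insert hb, Finset.sum_insert hb, ← ih]; rfl
      exact this _
    rw [e, Finset.mul_sum]
    refine Finset.sum_congr rfl fun S _ => ?_
    rw [pairing_shift]
    ring
  have hT : ∑ S ∈ c.support, (a S).1 φ * convTest (convDist T S).1 (derivTest^[k] φ) x
      = T.1 ψ := by
    simp only [ψ, map_sum, map_smul, smul_eq_mul]
    rfl
  have hsF : ContDiff ℝ ∞ F :=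
    ContDiff.sum fun S _ => contDiff_const.mul (contDiff_convTest S.1 _)
  have hsupp : ∀ z < -1, (derivTest^[k] φ) z = 0 := fun z hz => by
    have hz' : 1 < |z| := lt_of_lt_of_le (by linarith) (neg_le_abs z)
    have hev : ⇑φ =ᶠ[nhds z] fun _ => 0 := by
      filter_upwards [continuous_abs.continuousAt.eventually (lt_mem_nhds hz')] with w hw
      by_contra h0
      exact absurd ((abs_le_radius h0).trans h3.2) (not_le.2 hw)
    rw [coe_derivTest_iterate, hev.iteratedDeriv_eq]
    simp
  rw [hT]
  have hx' := hM x hx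
  refine (hb ψ (fun z => F (x - z)) (hsF.comp (contDiff_const.sub contDiff_id)) hψ
    (fun z hz => ?_) (radius φ ^ (p + 1)) (pow_nonneg h3.1.le _) fun j hj z hz => ?_).trans ?_
  · rw [hψ]
    by_cases h : z ≤ -2
    · rw [cutoff_of_le h, zero_mul]
    · have h4 : M + 2 < z := by
        rcases lt_abs.1 hz with h5 | h5 <;> linarith
      have : F (x - z) = 0 := Finset.sum_eq_zero fun S _ => by
        rw [convTest_eq_zero S _ hsupp (by linarith [le_abs_self x]), mul_zero]
      rw [this, mul_zero]
  · rw [iteratedDeriv_comp_const_sub, norm_smul, norm_pow, norm_neg, norm_one, one_pow, one_mul,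
      iteratedDeriv_sum_net, ← Function.iterate_add_apply, add_comm j k,
      ← iteratedDeriv_sum_net]
    refine h1 j hj _ ⟨?_, ?_⟩ <;>
      linarith [abs_le.1 hx' |>.1, abs_le.1 hx' |>.2, abs_le.1 hz |>.1, abs_le.1 hz |>.2]
  · calc C * radius φ ^ (p + 1) ≤ (radius φ)⁻¹ * radius φ ^ (p + 1) :=
          mul_le_mul_of_nonneg_right h2 (pow_nonneg h3.1.le _)
      _ = radius φ ^ p := by
          rw [pow_succ, mul_comm, mul_assoc, mul_inv_cancel₀ h3.1.ne', mul_one]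

theorem combinationConv_mem (T : DPlus) (c : DPlus →₀ CHat U) :
    combinationConv U T c ∈ hatSpan U DPlus := by
  rw [combinationConv, Finsupp.linearCombination_apply]
  exact Submodule.sum_mem _ fun S _ =>
    Submodule.smul_mem _ _ (Submodule.subset_span ⟨_, (convDist T S).2, rfl⟩)

/-- `combinationConv` as a map to the span. -/
noncomputable def combinationConv' (T : DPlus) :
    (DPlus →₀ CHat U) →ₗ[CHat U] hatSpan U (DPlus : Set Dist) :=
  (combinationConv U T).codRestrict _ (combinationConv_mem U T)

theorem ker_le' (T : DPlus) : (combination U).ker ≤ (combinationConv' U T).ker := by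
  rw [combinationConv', LinearMap.ker_codRestrict]
  exact ker_le U T

/-- The convolution `T ⋆ f = ∑ α_n ι(T ⋆ T_n)` of a distribution `T` supported by `[0, ∞)` and
an element `f = ∑ α_n ι(T_n)` of the span of the distributions supported by `[0, ∞)`. -/
noncomputable def conv (T : DPlus) :
    hatSpan U (DPlus : Set Dist) →ₗ[CHat U] hatSpan U (DPlus : Set Dist) :=
  ((combination U).ker.liftQ (combinationConv' U T) (ker_le' U T)).comp
  ((combination U).quotKerEquivRange.symm.toLinearMap.comp
    (LinearEquiv.ofEq _ _ (range_combination U).symm).toLinearMap)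

/-- The convolution does not depend on the representation `f = ∑ α_n ι(T_n)`. -/
theorem conv_sum (T : DPlus) {m : ℕ} (α : Fin m → CHat U) (S : Fin m → DPlus)
    (f : hatSpan U (DPlus : Set Dist)) (hf : (f : EHat U) = ∑ n, α n • iota U (S n).1) :
    (conv U T f : EHat U) = ∑ n, α n • iota U (convDist T (S n)).1 := by
  let c : DPlus →₀ CHat U := ∑ n, Finsupp.single (S n) (α n)
  have h1 : combination U c = f := by
    rw [hf, map_sum]
    exact Finset.sum_congr rfl fun n _ => Finsupp.linearCombination_single _ _ _
  have h2 : combinationConv U T c = ∑ n, α n • iota U (convDist T (S n)).1 := by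
    rw [map_sum]
    exact Finset.sum_congr rfl fun n _ => Finsupp.linearCombination_single _ _ _
  have h3 : (combination U).quotKerEquivRange.symm
      (LinearEquiv.ofEq _ _ (range_combination U).symm f) = (combination U).ker.mkQ c := by
    rw [LinearEquiv.symm_apply_eq]
    exact Subtype.ext h1.symm
  rw [← h2]
  change (((combination U).ker.liftQ (combinationConv' U T) (ker_le' U T) ((combination U).quotKerEquivRange.symm
    (LinearEquiv.ofEq _ _ (range_combination U).symm f))) : EHat U) = _
  rw [h3]
  rfl

end Span

/-! ### The Green function -/

section Green

/-- The distribution `ψ ↦ ∫ ψ(t) f(t) dt` given by a locally integrable function `f`. -/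
noncomputable def regular (f : ℝ → ℂ) : Dist :=
  TestFunction.integralAgainstBilinCLM (ContinuousLinearMap.mul ℂ ℂ) MeasureTheory.volume f

/-- The exponential function `t ↦ e^{-bt/a}`. -/
noncomputable def expFun (a b : ℝ) (t : ℝ) : ℂ := (Real.exp (-(b / a) * t) : ℝ)

/-- The function `t ↦ (1/a) H(t) e^{-bt/a}`. -/
noncomputable def greenFun (a b : ℝ) : ℝ → ℂ :=
  (Set.Ici (0 : ℝ)).indicator fun t => (1 / a : ℂ) * expFun a b t

/-- The distribution `g = (1/a) H(t) e^{-bt/a}`, an element of the space of distributions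
supported by `[0, ∞)`. -/
noncomputable def green (a b : ℝ) : DPlus :=
  ⟨regular (greenFun a b), fun ψ hψ => by
    change TestFunction.integralAgainstBilinCLM _ _ _ ψ = 0
    rw [TestFunction.integralAgainstBilinCLM_apply]
    split_ifs
    · refine MeasureTheory.integral_eq_zero_of_ae (Filter.Eventually.of_forall fun t => ?_)
      by_cases ht : 0 ≤ t
      · have : ψ t = 0 := image_eq_zero_of_notMem_tsupport fun h =>
          absurd (hψ h) (not_lt.2 ht)
        simp [this]
      · simp [greenFun, ht]
    · rfl⟩

/-- `G` is the Green function of `a d/dt + b`: it is supported by `[0, ∞)` and satisfies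
`a G' + b G = δ`, where `G'(ψ) = -G(ψ')`. -/
def IsGreenFunction (a b : ℝ) (G : DPlus) : Prop :=
  ∀ ψ : TestFn, (a : ℂ) * -(G.1 (derivTest ψ)) + (b : ℂ) * G.1 ψ = ψ 0

end Green

end GenFun

namespace GenFun

/-! ### The exponential function -/

section Exponential

/-! The classical argument works once three facts are secured for generalized functions.

Convolution with the Green function inverts the operator on the span. For a single distribution `S`
supported by the half-line, apply `a g' + b g = δ` to the test function `z ↦ η(z) (S ⋆ φ)(x - z)`,
with `η` the cutoff: the result is the exact identity `a (g ⋆ S ⋆ φ)' + b (g ⋆ S ⋆ φ) = S ⋆ φ` for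
every `φ` (`IsGreenFunction.convTest_convDist`). Since generalized constants have zero derivative,
the identity extends linearly to the span (`IsGreenFunction.ode_conv`).

The embedded exponential is the exponential. Exponentials are eigenfunctions of convolution, so `e ⋆
φ = c_φ e`. The vanishing moments of `φ` make `c_φ - 1` negligible, hence `ι(e)` is the class of the
constant net `e` (`iota_regular_expFun`). It therefore solves the homogeneous equation and takes the
value `1` at `0`, so subtracting `(g ⋆ f)(0) ι(e)` corrects the initial value without disturbing the
equation.

Uniqueness follows from an integrating factor: `e^{bt/a} u` has zero derivative and zero initial
value, and the mean value inequality then makes it negligible (`EHat.eq_zero_of_deriv_eq_zero`,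
`EHat.eq_zero_of_ode`). -/

theorem expFun_zero (a b : ℝ) : expFun a b 0 = 1 := by simp [expFun]

theorem expFun_add (a b s t : ℝ) : expFun a b (s + t) = expFun a b s * expFun a b t := by
  simp only [expFun]
  rw [mul_add, Real.exp_add, Complex.ofReal_mul]

/-- Replacing `b` by `-b` gives `e^{bt/a}`, so the integrating factor and its inverse belong to the
same family. -/
theorem expFun_neg_mul (a b t : ℝ) : expFun a (-b) t * expFun a b t = 1 := by
  rw [expFun, expFun, ← Complex.ofReal_mul, ← Real.exp_add]
  rw [show -(-b / a) * t + -(b / a) * t = 0 by ring]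
  simp

theorem hasDerivAt_expFun (a b t : ℝ) :
    HasDerivAt (expFun a b) (-(b / a : ℝ) * expFun a b t) t := by
  have h : HasDerivAt (fun t : ℝ => Real.exp (-(b / a) * t))
      (Real.exp (-(b / a) * t) * (-(b / a) * 1)) t :=
    ((hasDerivAt_id t).const_mul (-(b / a))).exp
  have := h.ofReal_comp
  refine this.congr_deriv ?_
  simp only [expFun]
  push_cast
  ring

theorem contDiff_expFun (a b : ℝ) : ContDiff ℝ ∞ (expFun a b) :=
  Complex.ofRealCLM.contDiff.comp (Real.contDiff_exp.comp (contDiff_const.mul contDiff_id))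

/-- Local integrability matters here: otherwise `regular f` takes the default value `0` instead of
the integral. -/
theorem regular_apply {f : ℝ → ℂ} (hf : MeasureTheory.LocallyIntegrable f) (ψ : TestFn) :
    regular f ψ = ∫ x, ψ x * f x := by
  rw [regular, TestFunction.integralAgainstBilinCLM_eq_integral (hf.locallyIntegrableOn _)]
  rfl

/-- Substituting `z = x - y` and using the addition law pulls out `e(x)`. The remaining factor does
not depend on `x`, so every comparison with `e` reduces to one scalar for each `φ`. -/
theorem convTest_regular_expFun (a b : ℝ) (φ : TestFn) (x : ℝ) :
    convTest (regular (expFun a b)) φ x =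
      (∫ z, φ z * expFun a b (-z)) * expFun a b x := by
  rw [convTest, regular_apply (contDiff_expFun a b).continuous.locallyIntegrable,
    ← MeasureTheory.integral_mul_const,
    ← MeasureTheory.integral_sub_left_eq_self (fun z => φ z * expFun a b (-z) * expFun a b x) _ x]
  refine MeasureTheory.integral_congr_ae (Filter.Eventually.of_forall fun y => ?_)
  simp only [shift_apply]
  rw [mul_assoc, ← expFun_add]
  congr 2
  ring

/-- This is the Taylor remainder of the complex exponential at `-(b/a) z`. It needs no smallness of
`z`, and its factor `|z| ^ n` later becomes a power of the radius. -/
theorem norm_expFun_sub_sum_le (a b z : ℝ) (n : ℕ) :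
    ‖expFun a b z - ∑ m ∈ Finset.range n, (-(b / a : ℝ) : ℂ) ^ m / m.factorial * (z : ℂ) ^ m‖ ≤
      (|b / a| * |z|) ^ n * Real.exp (|b / a| * |z|) := by
  have h := Complex.norm_exp_sub_sum_le_norm_mul_exp (((-(b / a) * z : ℝ)) : ℂ) n
  rw [Complex.norm_real, Real.norm_eq_abs, abs_mul, abs_neg] at h
  convert h using 3
  · rw [expFun, Complex.ofReal_exp]
  · refine Finset.sum_congr rfl fun m _ => ?_
    push_cast
    ring

/-- The test functions of the directing sequence almost reproduce the exponential function. -/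
theorem norm_integral_mul_expFun_sub_one_le (a b : ℝ) {n : ℕ} (hn : 1 ≤ n) {φ : TestFn}
    (hφ : φ ∈ directing n) :
    ‖(∫ z, φ z * expFun a b (-z)) - 1‖ ≤
      2 * (|b / a| ^ (n + 1) * Real.exp |b / a|) * radius φ ^ (n + 1) := by
  obtain ⟨-, -, hR, h1, hm, hL, -⟩ := hφ
  have hR1 : radius φ ≤ 1 := hR.trans (by
    rw [div_le_one (by positivity)]; exact_mod_cast hn)
  -- This bound on the `L¹` norm is the source of the factor `2` in the estimate.
  have hL2 : ∫ x, ‖φ x‖ ≤ 2 := hL.trans (by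
    have : 1 / (n : ℝ) ≤ 1 := by rw [div_le_one (by positivity)]; exact_mod_cast hn
    linarith)
  have hint : ∀ f : ℝ → ℂ, Continuous f → MeasureTheory.Integrable fun z => φ z * f z :=
    fun f hf => (φ.continuous.mul hf).integrable_of_hasCompactSupport
      φ.hasCompactSupport.mul_right
  -- The Taylor polynomial of `e^{bz/a}` of degree exactly `n`, the highest order of moment that
  -- vanishes on `directing n`. The double sign comes from writing `e(-z)` as the exponential with
  -- parameter `-b`.
  let P : ℝ → ℂ := fun z => ∑ m ∈ Finset.range (n + 1),
    (-(-b / a : ℝ) : ℂ) ^ m / m.factorial * (z : ℂ) ^ m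
  have hPc : Continuous P := by fun_prop
  have hneg : ∀ z, expFun a b (-z) = expFun a (-b) z := fun z => by
    rw [expFun, expFun, show -(b / a) * -z = -(-b / a) * z by ring]
  have hP : ∫ z, φ z * P z = 1 := by
    have e : ∀ z, φ z * P z = ∑ m ∈ Finset.range (n + 1),
        (-(-b / a : ℝ) : ℂ) ^ m / m.factorial * ((z : ℂ) ^ m * φ z) := fun z => by
      rw [Finset.mul_sum]
      exact Finset.sum_congr rfl fun m _ => by ring
    simp only [e]
    rw [MeasureTheory.integral_finsetSum]
    · simp only [MeasureTheory.integral_const_mul]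
      -- Only the constant term survives, and it contributes `∫ φ = 1`; the shifted indices `m + 1`
      -- run through `1, …, n`, where the moments vanish.
      rw [Finset.sum_range_succ', Finset.sum_eq_zero fun m hm' => ?_]
      · simp [h1]
      · rw [hm _ (by omega) (by have := Finset.mem_range.1 hm'; omega), mul_zero]
    · intro m _
      refine MeasureTheory.Integrable.const_mul ?_ _
      simp only [mul_comm _ (φ _)]
      exact hint _ (by fun_prop)
  simp only [hneg]
  rw [← hP, ← MeasureTheory.integral_sub (hint _ (contDiff_expFun a (-b)).continuous) (hint _ hPc)]
  let C : ℝ := |b / a| ^ (n + 1) * Real.exp |b / a| * radius φ ^ (n + 1)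
  have hC : 0 ≤ C := mul_nonneg (by positivity) (pow_nonneg (radius_nonneg φ) _)
  -- Off the support both sides vanish. On it `|z| ≤ radius φ ≤ 1`, so the power in the remainder is
  -- bounded by means of the radius and the exponential by means of `1`.
  have hb : ∀ z, ‖φ z * expFun a (-b) z - φ z * P z‖ ≤ C * ‖φ z‖ := fun z => by
    rw [← mul_sub, norm_mul, mul_comm]
    by_cases hz : φ z = 0
    · simp [hz]
    have hzR := abs_le_radius hz
    refine mul_le_mul_of_nonneg_right ?_ (norm_nonneg _)
    refine (norm_expFun_sub_sum_le a (-b) z (n + 1)).trans ?_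
    rw [neg_div, abs_neg, mul_pow]
    calc _ ≤ |b / a| ^ (n + 1) * radius φ ^ (n + 1) * Real.exp (|b / a| * 1) := by
          have := hzR.trans hR1
          have := pow_nonneg (radius_nonneg φ) (n + 1)
          gcongr
      _ = C := by rw [mul_one]; ring
  refine (MeasureTheory.norm_integral_le_of_norm_le
    ((φ.continuous.integrable_of_hasCompactSupport φ.hasCompactSupport).norm.const_mul C)
    (Filter.Eventually.of_forall hb)).trans ?_
  rw [MeasureTheory.integral_const_mul]
  calc C * ∫ x, ‖φ x‖ ≤ C * 2 := mul_le_mul_of_nonneg_left hL2 hC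
    _ = _ := by ring

end Exponential

/-! ### Calculus of generalized functions -/

section Calculus

variable (U : DirectedUltrafilter)

/-- The exponential function as a constant net of smooth functions. -/
noncomputable def expNet (a b : ℝ) : moderate U :=
  ⟨fun _ => expFun a b, fun _ => contDiff_expFun a b, fun K hK k => by
    obtain ⟨C, hC⟩ := hK.exists_bound_of_continuousOn
      ((contDiff_expFun a b).continuous_iteratedDeriv k (by exact_mod_cast le_top)).continuousOn
    exact (isMod_const (U := U) C).mono (Filter.Eventually.of_forall fun _ => hC)⟩

theorem derivNet_expNet (a b : ℝ) :
    derivNet U (expNet U a b) = (-(b / a : ℝ) : ℂ) • expNet U a b := by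
  ext φ x
  exact (hasDerivAt_expFun a b x).deriv

/-- The embedding regularizes with `φ`, so `ι(e)` is represented by `c_φ e` rather than by `e`; the
difference is negligible because `c_φ - 1` is. -/
theorem iota_regular_expFun (a b : ℝ) :
    iota U (regular (expFun a b)) = EHat.mk U (expNet U a b) := by
  have h : evalNet U 0 (iotaNet U (regular (expFun a b))) - 1 ∈ negligibleC U := fun p => by
    -- Membership in `directing (p + 1)` gives a constant times `radius φ ^ (p + 2)`. One power
    -- absorbs the constant, which is eventually at most the inverse radius.
    filter_upwards [eventually_directing (U := U) (n := p + 1) (by omega),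
      eventually_le_inv (U := U) (2 * (|b / a| ^ (p + 1 + 1) * Real.exp |b / a|)),
      eventually_radius_le (U := U) one_pos] with φ h1 h2 h3
    have := norm_integral_mul_expFun_sub_one_le a b (by omega) h1
    have e : (evalNet U 0 (iotaNet U (regular (expFun a b))) - 1).1 φ =
        (∫ z, φ z * expFun a b (-z)) - 1 := by
      change convTest (regular (expFun a b)) φ 0 - 1 = _
      rw [convTest_regular_expFun, expFun_zero, mul_one]
    rw [e]
    refine this.trans ((mul_le_mul_of_nonneg_right h2 (pow_nonneg h3.1.le _)).trans ?_)
    rw [pow_succ' (radius φ) (p + 1), ← mul_assoc, inv_mul_cancel₀ h3.1.ne', one_mul]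
    exact pow_le_pow_of_le_one h3.1.le h3.2 (by omega)
  rw [iota, EHat.mk_eq_mk]
  -- Since `e(0) = 1`, the eigenvalue `c_φ` is the value of the net at `0`. The difference is thus a
  -- multiple of a negligible constant net, and no derivative has to be estimated.
  have e : iotaNet U (regular (expFun a b)) - expNet U a b =
      expNet U a b * constNet U (evalNet U 0 (iotaNet U (regular (expFun a b))) - 1) := by
    ext φ x
    change convTest (regular (expFun a b)) φ x - expFun a b x =
      expFun a b x * (convTest (regular (expFun a b)) φ 0 - 1)
    rw [convTest_regular_expFun, convTest_regular_expFun, expFun_zero]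
    ring
  rw [e]
  exact Ideal.mul_mem_left _ _ (constNet_mem U h)

variable {U}

theorem EHat.deriv_mul (f g : EHat U) :
    EHat.deriv U (f * g) = EHat.deriv U f * g + f * EHat.deriv U g := by
  obtain ⟨f, rfl⟩ := EHat.mk_surjective f
  obtain ⟨g, rfl⟩ := EHat.mk_surjective g
  simp only [← map_mul, EHat.deriv_mk, ← map_add]
  congr 1
  ext φ x
  exact _root_.deriv_mul ((ContDiff.at_nat (f.2.1 φ) 1 x).differentiableAt (by simp))
    ((ContDiff.at_nat (g.2.1 φ) 1 x).differentiableAt (by simp))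

theorem EHat.deriv_const (c : CHat U) : EHat.deriv U (EHat.const U c) = 0 := by
  obtain ⟨A, rfl⟩ := CHat.mk_surjective c
  rw [EHat.const_mk, EHat.deriv_mk, ← map_zero (EHat.mk U)]
  congr 1
  ext φ x
  exact _root_.deriv_const x (A.1 φ)

/-- The derivative is linear over generalized scalars, not only over `ℂ`. This is needed both for
the coefficients of `f` and for the initial value `(g ⋆ f)(0)`. -/
theorem EHat.deriv_smul (c : CHat U) (f : EHat U) :
    EHat.deriv U (c • f) = c • EHat.deriv U f := by
  rw [EHat.smul_def, EHat.deriv_mul, EHat.deriv_const, zero_mul, zero_add, EHat.smul_def]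

theorem EHat.eval_const (x : ℝ) (c : CHat U) : EHat.eval U x (EHat.const U c) = c := by
  obtain ⟨A, rfl⟩ := CHat.mk_surjective c
  rfl

/-- A generalized function with zero derivative and zero initial value is zero. -/
theorem EHat.eq_zero_of_deriv_eq_zero {w : EHat U} (hd : EHat.deriv U w = 0)
    (h0 : EHat.eval U 0 w = 0) : w = 0 := by
  obtain ⟨F, rfl⟩ := EHat.mk_surjective w
  have hd' : derivNet U F ∈ negligible U := Ideal.Quotient.eq_zero_iff_mem.1 hd
  have h0' : evalNet U 0 F ∈ negligibleC U := Ideal.Quotient.eq_zero_iff_mem.1 h0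
  refine Ideal.Quotient.eq_zero_iff_mem.2 fun K hK k p => ?_
  cases k with
  | succ k =>
    filter_upwards [hd' K hK k p] with φ h x hx
    rw [iteratedDeriv_succ']
    exact h x hx
  | zero =>
    -- Only order zero uses the initial value. On a ball around `0` containing `K`, the mean value
    -- inequality bounds `F` by `r^(p+1) + r^(p+2) M`, where `r` is the radius; with `M ≤ 1/r` and
    -- `r ≤ 1/2` this is at most `r^p`.
    obtain ⟨M, hM⟩ := hK.isBounded.subset_closedBall 0
    filter_upwards [hd' _ (isCompact_closedBall 0 M) 0 (p + 2), h0' (p + 1),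
      eventually_le_inv (U := U) M, eventually_radius_le (U := U) (ε := 1 / 2) (by norm_num)]
      with φ h1 h2 h3 h4 x hx
    -- The point `x` of `K` shows that the ball is nonempty, so its centre `0` lies in it.
    have hM0 : 0 ≤ M := by
      have := hM hx
      exact (dist_nonneg.trans this)
    have hr := h4.1
    have key := Convex.norm_image_sub_le_of_norm_deriv_le (𝕜 := ℝ) (f := F.1 φ)
      (s := Metric.closedBall 0 M) (C := radius φ ^ (p + 2))
      (fun z _ => (ContDiff.at_nat (F.2.1 φ) 1 z).differentiableAt (by simp))
      (fun z hz => by simpa using! h1 z hz) (convex_closedBall _ _)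
      (Metric.mem_closedBall_self hM0) (hM hx)
    have h2' : ‖F.1 φ 0‖ ≤ radius φ ^ (p + 1) := h2
    have hxM : ‖x - 0‖ ≤ M := by simpa using hM hx
    have hMr : radius φ * M ≤ 1 := by
      calc radius φ * M ≤ radius φ * (radius φ)⁻¹ := mul_le_mul_of_nonneg_left h3 hr.le
        _ = 1 := mul_inv_cancel₀ hr.ne'
    rw [iteratedDeriv_zero]
    calc ‖F.1 φ x‖ ≤ ‖F.1 φ 0‖ + ‖F.1 φ x - F.1 φ 0‖ := by
          simpa using norm_add_le (F.1 φ 0) (F.1 φ x - F.1 φ 0)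
      _ ≤ radius φ ^ (p + 1) + radius φ ^ (p + 2) * M :=
          add_le_add h2' (key.trans (by gcongr))
      _ = radius φ ^ p * (radius φ + radius φ * (radius φ * M)) := by ring
      _ ≤ radius φ ^ p * 1 := by
          gcongr
          nlinarith [h4.2]
      _ = radius φ ^ p := mul_one _

/-- The homogeneous equation with zero initial value has only the zero solution. -/
theorem EHat.eq_zero_of_ode {a b : ℝ} (ha : a ≠ 0) {u : EHat U}
    (hu : (a : ℂ) • EHat.deriv U u + (b : ℂ) • u = 0) (h0 : EHat.eval U 0 u = 0) : u = 0 := by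
  -- The integrating factor `e^{bt/a}` is a unit, so it suffices to show that its product with `u`
  -- vanishes.
  have hinv : EHat.mk U (expNet U a (-b)) * EHat.mk U (expNet U a b) = 1 := by
    rw [← map_mul, ← map_one (EHat.mk U)]
    congr 1
    ext φ x
    exact expFun_neg_mul a b x
  have ha' : (a : ℂ) ≠ 0 := by exact_mod_cast ha
  have hu' : EHat.deriv U u = (-(b / a : ℝ) : ℂ) • u := by
    have h : (a : ℂ) • EHat.deriv U u = (-(b : ℂ)) • u := by
      rw [neg_smul]; exact eq_neg_of_add_eq_zero_left hu
    rw [← inv_smul_smul₀ ha' (EHat.deriv U u), h, smul_smul]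
    congr 1
    push_cast
    field_simp
  -- By the product rule the derivative of `e^{bt/a} u` is `(b/a - b/a) e^{bt/a} u = 0`.
  have hw : EHat.mk U (expNet U a (-b)) * u = 0 := by
    refine EHat.eq_zero_of_deriv_eq_zero ?_ (by rw [map_mul, h0, mul_zero])
    rw [EHat.deriv_mul, EHat.deriv_mk, derivNet_expNet, map_smul, hu', mul_smul_comm,
      smul_mul_assoc, ← add_smul]
    rw [show (-((-b / a : ℝ)) : ℂ) + -((b / a : ℝ) : ℂ) = 0 by push_cast; ring, zero_smul]
  calc u = EHat.mk U (expNet U a (-b)) * EHat.mk U (expNet U a b) * u := by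
        rw [hinv, one_mul]
    _ = EHat.mk U (expNet U a b) * (EHat.mk U (expNet U a (-b)) * u) := by ring
    _ = 0 := by rw [hw, mul_zero]

end Calculus

/-! ### The Green function -/

section GreenFunction

theorem locallyIntegrable_greenFun (a b : ℝ) : MeasureTheory.LocallyIntegrable (greenFun a b) :=
  ((continuous_const.mul (contDiff_expFun a b).continuous).locallyIntegrable).indicator
    measurableSet_Ici

/-- The endpoint `0` is a null set; the open half-line is the form in which the fundamental theorem
of calculus is applied. -/
theorem green_apply (a b : ℝ) (ψ : TestFn) :
    (green a b).1 ψ = ∫ x in Set.Ioi (0 : ℝ), (1 / a : ℂ) * (ψ x * expFun a b x) := by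
  change regular (greenFun a b) ψ = _
  rw [regular_apply (locallyIntegrable_greenFun a b), ← MeasureTheory.integral_Ici_eq_integral_Ioi,
    ← MeasureTheory.integral_indicator measurableSet_Ici]
  refine MeasureTheory.integral_congr_ae (Filter.Eventually.of_forall fun x => ?_)
  by_cases hx : x ∈ Set.Ici (0 : ℝ)
  · simp only [greenFun, Set.indicator_of_mem hx]
    ring
  · simp [greenFun, Set.indicator_of_notMem hx]

/-- Integration by parts: `(ψ e)' = ψ' e - (b/a) ψ e`, and its integral over the half-line is
`-ψ(0)` because `ψ` has compact support and `e(0) = 1`. Writing each term with the factor `1/a`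
turns the integrals into values of `g` at `ψ'` and `ψ`. -/
theorem isGreenFunction_green {a b : ℝ} (ha : a ≠ 0) : IsGreenFunction a b (green a b) := by
  intro ψ
  have ha' : (a : ℂ) ≠ 0 := by exact_mod_cast ha
  have hc := (contDiff_expFun a b).continuous
  have hint : ∀ φ : TestFn, MeasureTheory.IntegrableOn
      (fun x => (1 / a : ℂ) * (φ x * expFun a b x)) (Set.Ioi 0) := fun φ =>
    (((φ.continuous.mul hc).integrable_of_hasCompactSupport
      φ.hasCompactSupport.mul_right).const_mul _).integrableOn
  have hs : ContDiff ℝ ∞ fun x => ψ x * expFun a b x := (smooth ψ).mul (contDiff_expFun a b)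
  have h := HasCompactSupport.integral_Ioi_deriv_eq (hs.of_le (by exact_mod_cast le_top))
    (ψ.hasCompactSupport.mul_right (f' := expFun a b)) 0
  have hd : ∀ x, deriv (fun x => ψ x * expFun a b x) x =
      a * ((1 / a : ℂ) * (derivTest ψ x * expFun a b x)) -
        b * ((1 / a : ℂ) * (ψ x * expFun a b x)) := fun x => by
    have hψ : DifferentiableAt ℝ ψ x := (smooth ψ).differentiable (by simp) x
    have := (hψ.hasDerivAt.mul (hasDerivAt_expFun a b x)).deriv
    refine this.trans ?_
    rw [derivTest_apply]
    push_cast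
    field_simp
    ring
  simp only [hd] at h
  rw [MeasureTheory.integral_sub ((hint _).const_mul _) ((hint _).const_mul _),
    MeasureTheory.integral_const_mul (a : ℂ), MeasureTheory.integral_const_mul (b : ℂ),
    expFun_zero, mul_one, ← green_apply, ← green_apply] at h
  linear_combination -h

/-- A distribution supported by `[0, ∞)` vanishes on test functions that are zero on a
neighbourhood of `[0, ∞)`. -/
theorem DPlus_apply_eq_zero (G : DPlus) {ψ : TestFn} {B : ℝ} (hB : B < 0)
    (hψ : ∀ z, B < z → ψ z = 0) : G.1 ψ = 0 := by
  refine G.2 ψ ((closure_minimal (t := Set.Iic B) (fun z hz => ?_) isClosed_Iic).trans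
    fun z hz => lt_of_le_of_lt hz hB)
  by_contra h
  exact hz (hψ z (not_le.1 h))

theorem cutoff_of_ge {x : ℝ} (h : -1 ≤ x) : cutoff x = 1 := by
  simp [cutoff, Real.smoothTransition.one_of_one_le (show 1 ≤ x + 2 by linarith)]

/-- Convolution with a Green function inverts the differential operator. -/
theorem IsGreenFunction.convTest_convDist {a b : ℝ} {G : DPlus} (hG : IsGreenFunction a b G)
    (S : DPlus) (φ : TestFn) (x : ℝ) :
    (a : ℂ) * convTest (convDist G S).1 (derivTest φ) x
      + (b : ℂ) * convTest (convDist G S).1 φ x = convTest S.1 φ x := by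
  -- This test function is `z ↦ η(z) (S ⋆ φ)(x - z)`; its value at `0` is `(S ⋆ φ)(x)` since the
  -- cutoff is `1` there.
  have h := hG (pairing S (shift φ x))
  rw [pairing_shift, cutoff_of_ge (by norm_num), one_mul, sub_zero] at h
  -- Differentiating in `z` brings out a minus sign and moves the derivative to `φ`, up to a term
  -- with the derivative of the cutoff. That term vanishes for `z > -1`, hence near the support of
  -- `G`.
  have hz : G.1 (derivTest (pairing S (shift φ x)) + pairing S (shift (derivTest φ) x)) = 0 := by
    refine DPlus_apply_eq_zero G (B := -1) (by norm_num) fun z hz => ?_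
    change deriv (pairing S (shift φ x)) z + pairing S (shift (derivTest φ) x) z = 0
    have hev : ⇑(pairing S (shift φ x)) =ᶠ[nhds z] fun z => convTest S.1 φ (x - z) := by
      filter_upwards [lt_mem_nhds hz] with w hw
      rw [pairing_shift, cutoff_of_ge hw.le, one_mul]
    have hd : HasDerivAt (fun z => convTest S.1 φ (x - z))
        (-convTest S.1 (derivTest φ) (x - z)) z :=
      (hasDerivAt_convTest S.1 φ (x - z)).comp_const_sub x z
    rw [hev.deriv_eq, hd.deriv, pairing_shift, cutoff_of_ge hz.le, one_mul, neg_add_cancel]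
  rw [map_add] at hz
  change (a : ℂ) * G.1 (pairing S (shift (derivTest φ) x))
    + (b : ℂ) * G.1 (pairing S (shift φ x)) = _
  linear_combination h + (a : ℂ) * hz

variable {U : DirectedUltrafilter}

/-- The equation holds exactly for each representative, without a negligible error. -/
theorem IsGreenFunction.iota_convDist {a b : ℝ} {G : DPlus} (hG : IsGreenFunction a b G)
    (S : DPlus) :
    (a : ℂ) • EHat.deriv U (iota U (convDist G S).1) + (b : ℂ) • iota U (convDist G S).1 =
      iota U S.1 := by
  rw [iota, EHat.deriv_mk, ← map_smul (EHat.mk U), ← map_smul (EHat.mk U), ← map_add, iota]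
  congr 1
  ext φ x
  refine Eq.trans ?_ (hG.convTest_convDist S φ x)
  change (a : ℂ) * deriv (convTest (convDist G S).1 φ) x + _ = _
  rw [(hasDerivAt_convTest _ φ x).deriv]
  rfl

/-- Linearity over generalized scalars reduces the claim to the generators `ι(S)`. Any
representation of `f` may be used, by `conv_sum`. -/
theorem IsGreenFunction.ode_conv {a b : ℝ} {G : DPlus} (hG : IsGreenFunction a b G)
    (f : hatSpan U (DPlus : Set Dist)) :
    (a : ℂ) • EHat.deriv U (conv U G f : EHat U) + (b : ℂ) • (conv U G f : EHat U) = f := by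
  obtain ⟨m, α, S, hf⟩ : ∃ (m : ℕ) (α : Fin m → CHat U) (S : Fin m → DPlus),
      (f : EHat U) = ∑ n, α n • iota U (S n).1 := by
    obtain ⟨m, α, g, hg⟩ := Submodule.mem_span_set'.1 f.2
    choose T hT hTg using fun n => (g n).2
    refine ⟨m, α, fun n => ⟨T n, hT n⟩, hg.symm.trans ?_⟩
    exact Finset.sum_congr rfl fun n _ => by rw [hTg]
  rw [conv_sum U G α S f hf, hf, map_sum, Finset.smul_sum, Finset.smul_sum,
    ← Finset.sum_add_distrib]
  refine Finset.sum_congr rfl fun n _ => ?_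
  rw [EHat.deriv_smul, ← hG.iota_convDist (U := U) (S n)]
  simp only [EHat.smul_def, mul_add, mul_smul_comm]

end GreenFunction

end GenFun

/-! ### The initial value problem -/

theorem mainTheorem2 (U : GenFun.DirectedUltrafilter) (a b : ℝ) (ha : a ≠ 0) :
    GenFun.IsGreenFunction a b (GenFun.green a b) ∧
    ∀ f : GenFun.hatSpan U (GenFun.DPlus : Set GenFun.Dist),
      (∃! y : GenFun.EHat U,
        (a : ℂ) • GenFun.EHat.deriv U y + (b : ℂ) • y = (f : GenFun.EHat U) ∧
          GenFun.EHat.eval U 0 y = 0) ∧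
      ∀ y : GenFun.EHat U,
        (a : ℂ) • GenFun.EHat.deriv U y + (b : ℂ) • y = (f : GenFun.EHat U) ∧
          GenFun.EHat.eval U 0 y = 0 →
        y = (GenFun.conv U (GenFun.green a b) f : GenFun.EHat U) -
          GenFun.EHat.eval U 0 (GenFun.conv U (GenFun.green a b) f : GenFun.EHat U) •
            GenFun.iota U (GenFun.regular (GenFun.expFun a b)) := by
  have hG := GenFun.isGreenFunction_green (b := b) ha
  refine ⟨hG, fun f => ?_⟩
  have ha' : (a : ℂ) ≠ 0 := by exact_mod_cast ha
  have he : (a : ℂ) • GenFun.EHat.deriv U (GenFun.iota U (GenFun.regular (GenFun.expFun a b))) +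
      (b : ℂ) • GenFun.iota U (GenFun.regular (GenFun.expFun a b)) = 0 := by
    rw [GenFun.iota_regular_expFun, GenFun.EHat.deriv_mk, GenFun.derivNet_expNet, map_smul,
      smul_smul, ← add_smul]
    rw [show (a : ℂ) * -((b / a : ℝ) : ℂ) + b = 0 by push_cast; field_simp; ring, zero_smul]
  have he0 : GenFun.EHat.eval U 0 (GenFun.iota U (GenFun.regular (GenFun.expFun a b))) = 1 := by
    rw [GenFun.iota_regular_expFun, GenFun.EHat.eval_mk, ← map_one (GenFun.CHat.mk U)]
    congr 1
    ext φ
    exact GenFun.expFun_zero a b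
  have hsol := hG.ode_conv f
  -- From here on it only matters that `v` solves the equation and that `e` solves the homogeneous
  -- one with `e(0) = 1`.
  generalize (GenFun.conv U (GenFun.green a b) f : GenFun.EHat U) = v at hsol ⊢
  generalize GenFun.iota U (GenFun.regular (GenFun.expFun a b)) = e at he he0 ⊢
  have hy : (a : ℂ) • GenFun.EHat.deriv U (v - GenFun.EHat.eval U 0 v • e) +
      (b : ℂ) • (v - GenFun.EHat.eval U 0 v • e) = f ∧
      GenFun.EHat.eval U 0 (v - GenFun.EHat.eval U 0 v • e) = 0 := by
    constructor
    · have h : (a : ℂ) • GenFun.EHat.deriv U (GenFun.EHat.eval U 0 v • e) +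
          (b : ℂ) • (GenFun.EHat.eval U 0 v • e) = 0 := by
        rw [GenFun.EHat.deriv_smul, GenFun.EHat.smul_def, GenFun.EHat.smul_def,
          ← mul_smul_comm, ← mul_smul_comm, ← mul_add, he, mul_zero]
      rw [map_sub, smul_sub, smul_sub, sub_add_sub_comm, h, hsol, sub_zero]
    · rw [map_sub, GenFun.EHat.smul_def, map_mul, GenFun.EHat.eval_const, he0, mul_one, sub_self]
  have huniq : ∀ y : GenFun.EHat U,
      (a : ℂ) • GenFun.EHat.deriv U y + (b : ℂ) • y = (f : GenFun.EHat U) ∧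
        GenFun.EHat.eval U 0 y = 0 → y = v - GenFun.EHat.eval U 0 v • e := fun y hy' => by
    -- The difference of two solutions solves the homogeneous equation with zero initial value.
    refine sub_eq_zero.1 (GenFun.EHat.eq_zero_of_ode (a := a) (b := b) ha ?_ ?_)
    · rw [map_sub, smul_sub, smul_sub, sub_add_sub_comm, hy'.1, hy.1, sub_self]
    · rw [map_sub, hy'.2, hy.2, sub_self]
  exact ⟨⟨_, hy, huniq⟩, huniq⟩
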